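/- A \emph{convex polygon with $h$ convex holes} is a set $P=P_0\setminus\bigcup_{i=1}^h P_i\subset\mathbb{R}^2$, where $P_0$ is a (closed) convex polygon with nonempty interior and $P_1,\dots,P_h$ are pairwise disjoint closed convex polygons contained in the interior of $P_0$; the holes $P_i$ may degenerate to line segments or points. Let $|st|$ denote the Euclidean distance, and for $s,t\in P$ let $\mathrm{geod}(s,t)$ be the infimum of the lengths of polygonal paths from $s$ to $t$ contained in $P$. Put $\mathrm{diam}_2(P)=\sup_{s,t\in P}|st|$, $\mathrm{diam}_g(P)=\sup_{s,t\in P}\mathrm{geod}(s,t)$ and $\varrho(P)=\mathrm{diam}_g(P)/\mathrm{diam}_2(P)$. \textbf{Theorem.} There is an absolute constant $C>0$ such that the following holds for every integer $h\ge 0$ and every real $\Delta\ge 0$. If $P$ is a convex polygon with $h$ convex holes, each of Euclidean diameter at most $\Delta\cdot\mathrm{diam}_2(P)$, then $$\varrho(P)\le C\left(1+\min\{h^{3/4}\Delta,\;h^{1/2}\Delta^{1/2}\}\right).$$ In particular, for every constant $c>0$ there is a constant $C'>0$, depending only on $c$, such that for every integer $h\ge 1$ and every real $\Delta$ with $0\le\Delta\le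 c\,h^{-1/3}$, every convex polygon $P$ with $h$ convex holes, each of Euclidean diameter at most $\Delta\cdot\mathrm{diam}_2(P)$, satisfies $\varrho(P)\le C' h^{1/3}$. -/

import Mathlib

open scoped ENNReal

/-- The Euclidean plane. -/
abbrev Plane : Type := EuclideanSpace ℝ (Fin 2)

/-- A closed convex polygon: the convex hull of a nonempty finite set of points.
Degenerate polygons (segments and points) are included. -/
def IsConvexPolygon (C : Set Plane) : Prop :=
  ∃ V : Set Plane, V.Finite ∧ V.Nonempty ∧ C = convexHull ℝ V

/-- A convex polygon with `h` pairwise disjoint convex polygonal holes in its interior.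
The outer polygon is non-degenerate; holes may be degenerate. -/
structure ConvexDomain (h : ℕ) where
  outer : Set Plane
  hole : Fin h → Set Plane
  outer_polygon : IsConvexPolygon outer
  outer_interior : (interior outer).Nonempty
  hole_polygon : ∀ i, IsConvexPolygon (hole i)
  hole_subset : ∀ i, hole i ⊆ interior outer
  hole_disjoint : ∀ i j, i ≠ j → Disjoint (hole i) (hole j)

/-- The points of the polygonal domain: the outer polygon minus all holes. -/
def ConvexDomain.region {h : ℕ} (P : ConvexDomain h) : Set Plane :=
  P.outer \ ⋃ i, P.hole i

/-- `p 0, p 1, …, p n` are the vertices of a polygonal path from `s` to `t` contained in `R`. -/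
structure IsPolygonalPath (R : Set Plane) (s t : Plane) (n : ℕ) (p : ℕ → Plane) : Prop where
  start_eq : p 0 = s
  end_eq : p n = t
  vertex_mem : ∀ i ≤ n, p i ∈ R
  edge_subset : ∀ i < n, segment ℝ (p i) (p (i + 1)) ⊆ R

/-- The arclength of the polygonal path with vertices `p 0, p 1, …, p n`. -/
noncomputable def pathLength (n : ℕ) (p : ℕ → Plane) : ℝ≥0∞ :=
  ∑ i ∈ Finset.range n, edist (p i) (p (i + 1))

/-- The geodesic distance in `R`: the infimum of the arclengths of the polygonal paths
from `s` to `t` contained in `R` (and `∞` if there is none). -/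
noncomputable def geod (R : Set Plane) (s t : Plane) : ℝ≥0∞ :=
  ⨅ (n : ℕ) (p : ℕ → Plane) (_ : IsPolygonalPath R s t n p), pathLength n p

/-- The Euclidean diameter. -/
noncomputable def euclideanDiam (R : Set Plane) : ℝ≥0∞ :=
  ⨆ (s ∈ R) (t ∈ R), edist s t

/-- The geodesic diameter. -/
noncomputable def geodesicDiam (R : Set Plane) : ℝ≥0∞ :=
  ⨆ (s ∈ R) (t ∈ R), geod R s t

/-- The distortion of a polygonal domain: geodesic diameter over Euclidean diameter.
The denominator is neither `0` nor `∞`, as the outer polygon is non-degenerate and bounded. -/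
noncomputable def distortion {h : ℕ} (P : ConvexDomain h) : ℝ≥0∞ :=
  geodesicDiam P.region / euclideanDiam P.region

/-! ### Geodesic distance -/

/-! Let `D` be the diameter of the outer polygon. It suffices to escape from any point to the outer
boundary, since two boundary points are joined along it at cost `32 D` (`IsWall.geod_boundary_le`).
Slightly thickened holes are disjoint convex bodies, of diameter at most some `d`, whose boundaries
may be walked (`ConvexDomain.exists_obstacleField`).

A rising path moves vertically until it hits an obstacle, then slides up the obstacle's boundary on
the ascending side to its extreme point. Relative to a level function `Y`, a slide costs `O(N)`
times its rise, except on the flat part of the boundary, of slope below `1/N`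
(`ObliqueFrame.slide`). A passed obstacle is never hit again (`ObliqueFrame.Passed`), so the excess
is at most twice the total width of the flat parts (`IsObstacleField.ascend`). As `Y` runs through
`N` slopes, the flat parts of one obstacle cover its lower boundary at most twice, so their widths
sum to at most `2 d`. Hence some slope has total flat width at most `2 h d / N`, and climbing by `r`
costs `O(h d / N + N r)` (`IsObstacleField.exists_frame`).

Climbing all the way to the outer boundary with `N` about `√(h d / D)` gives the term `√(h Δ)`.
Alternatively, climb by at most `r` to a level that meets only `O(h d / r)` obstacles and follow
that level, walking around each obstacle at cost `O(d)`. With `N` about `h^(1/4)` and `r` about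
`h^(1/2) d` this gives `h^(3/4) Δ`. -/

lemma geod_le_of_path {R : Set Plane} {s t : Plane} {n : ℕ} {p : ℕ → Plane}
    (hp : IsPolygonalPath R s t n p) : geod R s t ≤ pathLength n p :=
  (iInf_le _ n).trans ((iInf_le _ p).trans (iInf_le _ hp))

lemma geod_le_edist {R : Set Plane} {s t : Plane} (hst : segment ℝ s t ⊆ R) :
    geod R s t ≤ edist s t := by
  refine (geod_le_of_path (n := 1) (p := fun i => if i = 0 then s else t) ?_).trans ?_
  · refine ⟨by simp, by simp, fun i _ => ?_, fun i hi => ?_⟩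
    · by_cases h0 : i = 0
      · simpa [h0] using hst (left_mem_segment ℝ s t)
      · simpa [h0] using hst (right_mem_segment ℝ s t)
    · obtain rfl : i = 0 := by omega
      simpa using hst
  · simp [pathLength]

lemma IsPolygonalPath.symm {R : Set Plane} {s t : Plane} {n : ℕ} {p : ℕ → Plane}
    (hp : IsPolygonalPath R s t n p) : IsPolygonalPath R t s n (fun i => p (n - i)) where
  start_eq := by simpa using hp.end_eq
  end_eq := by simpa using hp.start_eq
  vertex_mem i _ := hp.vertex_mem _ (by omega)
  edge_subset i hi := by
    have h1 := hp.edge_subset (n - (i + 1)) (by omega)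
    have h2 : n - (i + 1) + 1 = n - i := by omega
    rw [h2, segment_symm] at h1
    exact h1

lemma pathLength_symm (n : ℕ) (p : ℕ → Plane) :
    pathLength n (fun i => p (n - i)) = pathLength n p := by
  unfold pathLength
  rw [← Finset.sum_range_reflect]
  refine Finset.sum_congr rfl fun i hi => ?_
  have hi : i < n := Finset.mem_range.1 hi
  have h1 : n - (n - 1 - i) = i + 1 := by omega
  have h2 : n - (n - 1 - i + 1) = i := by omega
  simp only [h1, h2, edist_comm]

lemma geod_comm_le (R : Set Plane) (s t : Plane) : geod R t s ≤ geod R s t := by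
  refine le_iInf fun n => le_iInf fun p => le_iInf fun hp => ?_
  rw [← pathLength_symm]
  exact geod_le_of_path hp.symm

lemma geod_comm (R : Set Plane) (s t : Plane) : geod R s t = geod R t s :=
  le_antisymm (geod_comm_le R t s) (geod_comm_le R s t)

lemma geod_triangle (R : Set Plane) (s t u : Plane) :
    geod R s u ≤ geod R s t + geod R t u := by
  unfold geod
  simp only [ENNReal.iInf_add, ENNReal.add_iInf]
  refine le_iInf fun m => le_iInf fun q => le_iInf fun hq => le_iInf fun n => le_iInf fun p =>
    le_iInf fun hp => ?_
  have hpath : IsPolygonalPath R s u (n + m) (fun i => if i ≤ n then p i else q (i - n)) := by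
    have hjoin : p n = q 0 := hp.end_eq.trans hq.start_eq.symm
    refine ⟨by simpa using hp.start_eq, ?_, fun i hi => ?_, fun i hi => ?_⟩
    · by_cases hm : m = 0
      · subst hm
        simpa [hjoin] using hq.end_eq
      · simpa [hm] using hq.end_eq
    · by_cases h : i ≤ n
      · simpa [h] using hp.vertex_mem i h
      · simpa [h] using hq.vertex_mem (i - n) (by omega)
    · rcases lt_trichotomy i n with h | h | h
      · have h1 : i + 1 ≤ n := h
        simpa [h.le, h1] using hp.edge_subset i h
      · subst h
        have := hq.edge_subset 0 (by omega)
        simpa [hjoin] using this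
      · have h1 : ¬ i ≤ n := by omega
        have h2 : ¬ i + 1 ≤ n := by omega
        have h3 : i + 1 - n = i - n + 1 := by omega
        simpa [h1, h2, h3] using hq.edge_subset (i - n) (by omega)
  refine (geod_le_of_path hpath).trans (le_of_eq ?_)
  unfold pathLength
  rw [Finset.sum_range_add]
  congr 1
  · refine Finset.sum_congr rfl fun i hi => ?_
    have hi : i < n := Finset.mem_range.1 hi
    have h1 : i + 1 ≤ n := hi
    simp [hi.le, h1]
  · refine Finset.sum_congr rfl fun i hi => ?_
    have h3 : n + i + 1 - n = i + 1 := by omega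
    rcases Nat.eq_zero_or_pos i with h | h
    · subst h
      simp [hp.end_eq, hq.start_eq]
    · have h1 : ¬ n + i ≤ n := by omega
      have h2 : ¬ n + i + 1 ≤ n := by omega
      simp [h2, h3, h.ne']

lemma geod_trans {R : Set Plane} {s t u : Plane} {a b : ℝ} (ha : 0 ≤ a) (hb : 0 ≤ b)
    (h1 : geod R s t ≤ ENNReal.ofReal a) (h2 : geod R t u ≤ ENNReal.ofReal b) :
    geod R s u ≤ ENNReal.ofReal (a + b) := by
  rw [ENNReal.ofReal_add ha hb]
  exact (geod_triangle R s t u).trans (add_le_add h1 h2)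

lemma geod_le_dist {R : Set Plane} {s t : Plane} (hst : segment ℝ s t ⊆ R) :
    geod R s t ≤ ENNReal.ofReal (dist s t) := by
  rw [← edist_dist]
  exact geod_le_edist hst

/-- A Lipschitz curve in a relatively open subset of a convex set can be replaced by an inscribed
polygonal path. -/
lemma geod_le_of_lipschitz {R C V : Set Plane} (hC : Convex ℝ C) (hV : IsOpen V) (hR : C ∩ V ⊆ R)
    {γ : ℝ → Plane} {L : NNReal} (hγ : LipschitzWith L γ) {a b : ℝ} (hab : a ≤ b)
    (hmem : ∀ t ∈ Set.Icc a b, γ t ∈ C ∩ V) :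
    geod R (γ a) (γ b) ≤ ENNReal.ofReal (L * (b - a)) := by
  have hK : IsCompact (γ '' Set.Icc a b) := isCompact_Icc.image hγ.continuous
  -- The compact curve has a margin `δ` inside `V`, so inscribed edges shorter than `δ` stay in `V`.
  -- Convexity keeps them in `C`.
  obtain ⟨δ, hδ, hδV⟩ := hK.exists_thickening_subset_open hV
    (by rintro _ ⟨t, ht, rfl⟩; exact (hmem t ht).2)
  obtain ⟨n, hn⟩ := exists_nat_gt (L * (b - a) / δ)
  have hLab : 0 ≤ L * (b - a) := mul_nonneg L.2 (sub_nonneg.2 hab)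
  have hn0 : (0 : ℝ) < n := lt_of_le_of_lt (div_nonneg hLab hδ.le) hn
  have hstep : L * (b - a) / n < δ := by
    rw [div_lt_iff₀ hδ] at hn
    rw [div_lt_iff₀ hn0]
    linarith
  set τ : ℕ → ℝ := fun i => a + (b - a) * (i / n) with hτ
  have hτmem : ∀ i ≤ n, τ i ∈ Set.Icc a b := by
    intro i hi
    have h1 : (i : ℝ) / n ≤ 1 := (div_le_one hn0).2 (by exact_mod_cast hi)
    have h2 : (0 : ℝ) ≤ i / n := by positivity
    constructor
    · have := mul_nonneg (sub_nonneg.2 hab) h2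
      simp only [hτ]; linarith
    · have := mul_le_mul_of_nonneg_left h1 (sub_nonneg.2 hab)
      simp only [hτ]; linarith
  have hedge : ∀ i, dist (γ (τ i)) (γ (τ (i + 1))) ≤ L * (b - a) / n := by
    intro i
    refine (hγ.dist_le_mul _ _).trans (le_of_eq ?_)
    have : τ i - τ (i + 1) = -((b - a) / n) := by
      simp only [hτ]; push_cast; field_simp; ring
    rw [Real.dist_eq, this, abs_neg, abs_of_nonneg (div_nonneg (sub_nonneg.2 hab) hn0.le)]
    ring
  have hpath : IsPolygonalPath R (γ a) (γ b) n (fun i => γ (τ i)) := by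
    refine ⟨by simp [hτ], ?_, fun i hi => hR (hmem _ (hτmem i hi)), fun i hi z hz => ?_⟩
    · have : τ n = b := by simp only [hτ]; field_simp; ring
      simp [this]
    · have hi1 : i + 1 ≤ n := hi
      refine hR ⟨hC.segment_subset (hmem _ (hτmem i hi.le)).1 (hmem _ (hτmem _ hi1)).1 hz,
        hδV ?_⟩
      rw [Metric.mem_thickening_iff]
      refine ⟨γ (τ i), ⟨τ i, hτmem i hi.le, rfl⟩, ?_⟩
      have hz' := (convex_ball (γ (τ i)) δ).segment_subset (Metric.mem_ball_self hδ)
        (Metric.mem_ball.2 (by rw [dist_comm]; exact (hedge i).trans_lt hstep)) hz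
      exact Metric.mem_ball.1 hz'
  refine (geod_le_of_path hpath).trans ?_
  unfold pathLength
  calc ∑ i ∈ Finset.range n, edist (γ (τ i)) (γ (τ (i + 1)))
      ≤ ∑ i ∈ Finset.range n, ENNReal.ofReal (L * (b - a) / n) := by
        refine Finset.sum_le_sum fun i _ => ?_
        rw [edist_dist]
        exact ENNReal.ofReal_le_ofReal (hedge i)
    _ = ENNReal.ofReal (L * (b - a)) := by
        rw [Finset.sum_const, Finset.card_range, nsmul_eq_mul, ← ENNReal.ofReal_natCast,
          ← ENNReal.ofReal_mul (by positivity)]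
        congr 1
        field_simp

/-! ### Metric projection onto a closed convex set -/

/-- `π` is the metric projection onto `K`, given by its variational inequality. -/
structure IsMetricProj (K : Set Plane) (π : Plane → Plane) : Prop where
  mem : ∀ u, π u ∈ K
  inner_le : ∀ u, ∀ w ∈ K, inner ℝ (u - π u) (w - π u) ≤ 0

lemma exists_isMetricProj {K : Set Plane} (hK : IsClosed K) (hconv : Convex ℝ K)
    (hne : K.Nonempty) : ∃ π, IsMetricProj K π := by
  have h : ∀ u : Plane, ∃ v ∈ K, ∀ w ∈ K, inner ℝ (u - v) (w - v) ≤ 0 := by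
    intro u
    obtain ⟨v, hv, hmin⟩ := exists_norm_eq_iInf_of_complete_convex hne hK.isComplete hconv u
    exact ⟨v, hv, (norm_eq_iInf_iff_real_inner_le_zero hconv hv).1 hmin⟩
  choose π h1 h2 using h
  exact ⟨π, h1, h2⟩

namespace IsMetricProj

variable {K : Set Plane} {π : Plane → Plane}

lemma lipschitz (hπ : IsMetricProj K π) : LipschitzWith 1 π := by
  refine LipschitzWith.of_dist_le_mul fun u v => ?_
  have h1 := hπ.inner_le u _ (hπ.mem v)
  have h2 := hπ.inner_le v _ (hπ.mem u)
  rw [NNReal.coe_one, one_mul, dist_eq_norm, dist_eq_norm]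
  have h3 : ‖π u - π v‖ * ‖π u - π v‖ ≤ ‖u - v‖ * ‖π u - π v‖ := by
    rw [← real_inner_self_eq_norm_mul_norm]
    refine le_trans ?_ (real_inner_le_norm (u - v) (π u - π v))
    have e1 : inner ℝ (u - v) (π u - π v) - inner ℝ (π u - π v) (π u - π v)
        = -inner ℝ (u - π u) (π v - π u) - inner ℝ (v - π v) (π u - π v) := by
      simp only [inner_sub_left, inner_sub_right]
      ring
    linarith
  rcases (norm_nonneg (π u - π v)).eq_or_lt with h | h
  · rw [← h]; exact norm_nonneg _
  · exact le_of_mul_le_mul_right h3 h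

lemma eq_of_inner_le (hπ : IsMetricProj K π) {u v : Plane} (hv : v ∈ K)
    (h : ∀ w ∈ K, inner ℝ (u - v) (w - v) ≤ 0) : π u = v := by
  have h1 := hπ.inner_le u v hv
  have h2 := h _ (hπ.mem u)
  have e : inner ℝ (v - π u) (v - π u)
      = inner ℝ (u - π u) (v - π u) + inner ℝ (u - v) (π u - v) := by
    simp only [inner_sub_left, inner_sub_right]
    ring
  have h3 : inner ℝ (v - π u) (v - π u) ≤ 0 := by linarith
  exact (sub_eq_zero.1 (real_inner_self_nonpos.1 h3)).symm

lemma eq_self (hπ : IsMetricProj K π) {u : Plane} (hu : u ∈ K) : π u = u :=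
  hπ.eq_of_inner_le hu fun w _ => by simp

/-- From an interior point `π u` one could step towards `u` inside `K`, and the variational
inequality would force `π u = u`. -/
lemma notMem_interior (hπ : IsMetricProj K π) {u : Plane} (hu : u ∉ interior K) :
    π u ∉ interior K := by
  intro h
  have hcont : Filter.Tendsto (fun t : ℝ => π u + t • (u - π u)) (nhdsWithin 0 (Set.Ioi 0))
      (nhds (π u)) := by
    have : Continuous (fun t : ℝ => π u + t • (u - π u)) := by fun_prop
    have h0 := this.tendsto 0
    simp only [zero_smul, add_zero] at h0
    exact h0.mono_left nhdsWithin_le_nhds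
  have hev := hcont.eventually (mem_interior_iff_mem_nhds.1 h)
  obtain ⟨t, ht, ht0⟩ := (hev.and self_mem_nhdsWithin).exists
  have h1 := hπ.inner_le u _ ht
  rw [add_sub_cancel_left, inner_smul_right] at h1
  have h2 : inner ℝ (u - π u) (u - π u) ≤ 0 := by
    by_contra! h3
    exact absurd (mul_pos ht0 h3) (not_lt.2 h1)
  have h3 := sub_eq_zero.1 (real_inner_self_nonpos.1 h2)
  exact hu (h3 ▸ h)

end IsMetricProj

/-- `K` is a convex body in the convex set `C` whose boundary lies in the open set `V`, and
`C ∩ V` is contained in `R`. -/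
structure IsWall (R C V K : Set Plane) : Prop where
  convex_ambient : Convex ℝ C
  isOpen : IsOpen V
  inter_subset : C ∩ V ⊆ R
  compact : IsCompact K
  convex : Convex ℝ K
  nonempty_interior : (interior K).Nonempty
  subset : K ⊆ C
  boundary_subset : K \ interior K ⊆ V

namespace IsWall

variable {R C V K : Set Plane}

lemma nonempty (hK : IsWall R C V K) : K.Nonempty := hK.nonempty_interior.mono interior_subset

lemma boundary_subset_region (hK : IsWall R C V K) : K \ interior K ⊆ R :=
  fun _ hx => hK.inter_subset ⟨hK.subset hx.1, hK.boundary_subset hx⟩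

/-- Pushing a curve outside the convex body `K` onto the boundary of `K`. -/
lemma geod_proj_le (hK : IsWall R C V K) {π : Plane → Plane} (hπ : IsMetricProj K π)
    {γ : ℝ → Plane} {L : NNReal} (hγ : LipschitzWith L γ) {a b : ℝ} (hab : a ≤ b)
    (hmem : ∀ t ∈ Set.Icc a b, γ t ∉ interior K) :
    geod R (π (γ a)) (π (γ b)) ≤ ENNReal.ofReal (L * (b - a)) := by
  have hl : LipschitzWith L (π ∘ γ) := by simpa using hπ.lipschitz.comp hγ
  refine geod_le_of_lipschitz hK.convex_ambient hK.isOpen hK.inter_subset hl hab fun t ht => ?_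
  exact ⟨hK.subset (hπ.mem _),
    hK.boundary_subset ⟨hπ.mem _, hπ.notMem_interior (hmem t ht)⟩⟩

lemma geod_proj_segment_le (hK : IsWall R C V K) {π : Plane → Plane} (hπ : IsMetricProj K π)
    {x y : Plane} (hxy : ∀ z ∈ segment ℝ x y, z ∉ interior K) :
    geod R (π x) (π y) ≤ ENNReal.ofReal (dist x y) := by
  have hl : LipschitzWith (nndist x y) (AffineMap.lineMap x y : ℝ → Plane) :=
    lipschitzWith_lineMap x y
  have := hK.geod_proj_le hπ hl zero_le_one (fun t ht => hxy _ (by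
    rw [segment_eq_image_lineMap]; exact ⟨t, ht, rfl⟩))
  simpa using this

end IsWall

/-! ### Walking around a convex body -/

lemma exists_angle {w : Plane} {r : ℝ} (hr : 0 < r) (hw : ‖w‖ = r) :
    ∃ θ ∈ Set.Icc (-Real.pi) Real.pi, w = !₂[r * Real.cos θ, r * Real.sin θ] := by
  have hn : ‖(⟨w 0, w 1⟩ : ℂ)‖ = r := by
    rw [← hw, EuclideanSpace.norm_eq, Complex.norm_def, Complex.normSq_apply]
    simp [Fin.sum_univ_two, sq]
  have h0 : (⟨w 0, w 1⟩ : ℂ) ≠ 0 := by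
    rw [← norm_pos_iff, hn]; exact hr
  refine ⟨Complex.arg ⟨w 0, w 1⟩, ⟨(Complex.neg_pi_lt_arg _).le, Complex.arg_le_pi _⟩, ?_⟩
  rw [Complex.cos_arg h0, Complex.sin_arg, hn]
  ext i
  fin_cases i
  · simp; field_simp
  · simp; field_simp

lemma lipschitz_circle (c : Plane) {r : NNReal} :
    LipschitzWith (2 * r)
      (fun θ : ℝ => c + (!₂[(r : ℝ) * Real.cos θ, (r : ℝ) * Real.sin θ] : Plane)) := by
  refine LipschitzWith.of_dist_le_mul fun s t => ?_
  rw [dist_add_left, EuclideanSpace.dist_eq, Fin.sum_univ_two]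
  simp only [Real.dist_eq, sq_abs]
  rw [Real.sqrt_le_left (by positivity)]
  have h1 : (Real.cos s - Real.cos t) ^ 2 ≤ |s - t| ^ 2 := by
    rw [← sq_abs (Real.cos s - Real.cos t)]
    exact pow_le_pow_left₀ (abs_nonneg _) (Real.abs_cos_sub_cos_le s t) 2
  have h2 : (Real.sin s - Real.sin t) ^ 2 ≤ |s - t| ^ 2 := by
    rw [← sq_abs (Real.sin s - Real.sin t)]
    exact pow_le_pow_left₀ (abs_nonneg _) (Real.abs_sin_sub_sin_le s t) 2
  have h3 : (0 : ℝ) ≤ (r : ℝ) ^ 2 := by positivity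
  simp
  nlinarith [mul_le_mul_of_nonneg_left h1 h3, mul_le_mul_of_nonneg_left h2 h3, mul_nonneg h3 (sq_nonneg (s - t)), sq_abs (s - t)]

namespace IsWall

variable {R C V K : Set Plane}

/-- Every boundary point of a convex body has an outer unit normal. -/
lemma exists_normal (hK : IsWall R C V K) {p : Plane} (hp : p ∉ interior K) :
    ∃ n : Plane, ‖n‖ = 1 ∧ ∀ w ∈ K, inner ℝ n (w - p) ≤ 0 := by
  obtain ⟨f, hf⟩ := geometric_hahn_banach_open_point hK.convex.interior isOpen_interior hp
  obtain ⟨v, hv⟩ := (InnerProductSpace.toDual ℝ Plane).surjective f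
  have hfv : ∀ x, f x = inner ℝ v x := fun x => by rw [← hv]; simp
  obtain ⟨x₀, hx₀⟩ := hK.nonempty_interior
  have hv0 : v ≠ 0 := by
    rintro rfl
    have := hf x₀ hx₀
    simp [hfv] at this
  have hle : ∀ w ∈ K, f w ≤ f p := by
    intro w hw
    have hw' : w ∈ closure (interior K) := by
      rw [hK.convex.closure_interior_eq_closure_of_nonempty_interior ⟨x₀, hx₀⟩]
      exact subset_closure hw
    exact closure_minimal (s := interior K) (t := {x | f x ≤ f p}) (fun x hx => (hf x hx).le)
      (isClosed_le f.continuous continuous_const) hw'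
  refine ⟨‖v‖⁻¹ • v, norm_smul_inv_norm (𝕜 := ℝ) hv0, fun w hw => ?_⟩
  have h1 := hle w hw
  rw [hfv, hfv] at h1
  rw [real_inner_smul_left, inner_sub_right]
  exact mul_nonpos_of_nonneg_of_nonpos (by positivity) (by linarith)

/-- The projection is constantly `p` along the outer normal ray at `p`. That ray starts within `D`
of `c` and at parameter `3 D` is at distance at least `2 D`, so it crosses the sphere. -/
lemma exists_proj_eq_sphere (hK : IsWall R C V K) {π : Plane → Plane} (hπ : IsMetricProj K π)
    {c p : Plane} (hc : c ∈ K) (hp : p ∈ K \ interior K) {D : ℝ} (hD : 0 ≤ D)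
    (hdiam : ∀ x ∈ K, ∀ y ∈ K, dist x y ≤ D) : ∃ z, ‖z - c‖ = 2 * D ∧ π z = p := by
  obtain ⟨n, hn, hle⟩ := hK.exists_normal hp.2
  have hcont : Continuous (fun t : ℝ => ‖p + t • n - c‖) := by fun_prop
  have h0 : ‖p + (0 : ℝ) • n - c‖ ≤ 2 * D := by
    have := hdiam p hp.1 c hc
    rw [dist_eq_norm] at this
    simp only [zero_smul, add_zero]
    linarith
  have h1 : 2 * D ≤ ‖p + (3 * D) • n - c‖ := by
    have h2 := hdiam p hp.1 c hc
    rw [dist_eq_norm, norm_sub_rev] at h2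
    have h3 : ‖(3 * D) • n‖ = 3 * D := by
      rw [norm_smul, hn, Real.norm_of_nonneg (by positivity), mul_one]
    have h4 := norm_sub_norm_le ((3 * D) • n) (c - p)
    have h5 : (3 * D) • n - (c - p) = p + (3 * D) • n - c := by abel
    rw [h5, h3] at h4
    linarith
  obtain ⟨t, ht, hteq⟩ := intermediate_value_Icc (by positivity : (0 : ℝ) ≤ 3 * D)
    hcont.continuousOn ⟨h0, h1⟩
  refine ⟨p + t • n, hteq, hπ.eq_of_inner_le hp.1 fun w hw => ?_⟩
  rw [add_sub_cancel_left, real_inner_smul_left]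
  exact mul_nonpos_of_nonneg_of_nonpos ht.1 (hle w hw)

/-- A circle about `p` of radius `2 D` misses `K`, and its projection covers the whole boundary of
`K`. An arc of the circle therefore projects to a boundary walk from `p` to `q`. -/
lemma geod_boundary_le (hK : IsWall R C V K) {p q : Plane} (hp : p ∈ K \ interior K)
    (hq : q ∈ K \ interior K) {D : ℝ} (hD : 0 < D) (hdiam : ∀ x ∈ K, ∀ y ∈ K, dist x y ≤ D) :
    geod R p q ≤ ENNReal.ofReal (32 * D) := by
  obtain ⟨π, hπ⟩ := exists_isMetricProj hK.compact.isClosed hK.convex hK.nonempty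
  lift D to NNReal using hD.le
  set γ : ℝ → Plane := fun θ =>
    p + (!₂[((2 * D : NNReal) : ℝ) * Real.cos θ, ((2 * D : NNReal) : ℝ) * Real.sin θ] : Plane)
    with hγ
  have hout : ∀ θ, γ θ ∉ interior K := by
    intro θ hθ
    have h1 := hdiam _ (interior_subset hθ) p hp.1
    have h2 : dist (γ θ) p = 2 * D := by
      simp only [hγ, dist_eq_norm, add_sub_cancel_left, EuclideanSpace.norm_eq, Fin.sum_univ_two]
      refine (congrArg Real.sqrt ?_).trans (Real.sqrt_sq (by positivity))
      simp only [NNReal.coe_mul, NNReal.coe_ofNat, Real.norm_eq_abs, sq_abs]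
      simp
      linear_combination (4 * (D : ℝ) ^ 2) * Real.cos_sq_add_sin_sq θ
    linarith
  have hangle : ∀ x ∈ K \ interior K, ∃ θ ∈ Set.Icc (-Real.pi) Real.pi, π (γ θ) = x := by
    intro x hx
    obtain ⟨z, hz, hzx⟩ := hK.exists_proj_eq_sphere hπ hp.1 hx hD.le hdiam
    obtain ⟨θ, hθ, h⟩ := exists_angle (by positivity) hz
    refine ⟨θ, hθ, ?_⟩
    rw [← hzx]
    congr 1
    simp only [hγ, NNReal.coe_mul, NNReal.coe_ofNat, ← h, add_sub_cancel]
  have hle : ∀ s ∈ Set.Icc (-Real.pi) Real.pi, ∀ t ∈ Set.Icc (-Real.pi) Real.pi, s ≤ t →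
      geod R (π (γ s)) (π (γ t)) ≤ ENNReal.ofReal (32 * D) := by
    intro s hs t ht hst
    refine (hK.geod_proj_le hπ (lipschitz_circle p) hst fun θ _ => hout θ).trans
      (ENNReal.ofReal_le_ofReal ?_)
    -- The parametrisation is `4 D`-Lipschitz and the angle at most `8`, whence `32 D`.
    have h1 : t - s ≤ 8 := by linarith [hs.1, ht.2, Real.pi_le_four]
    push_cast
    nlinarith [mul_le_mul_of_nonneg_left h1 hD.le]
  obtain ⟨s, hs, hsp⟩ := hangle p hp
  obtain ⟨t, ht, htq⟩ := hangle q hq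
  rcases le_total s t with h | h
  · have := hle s hs t ht h
    rwa [hsp, htq] at this
  · have := hle t ht s hs h
    rwa [hsp, htq, geod_comm] at this

end IsWall

/-! ### Oblique frames -/

/-- Linear coordinates `X`, `Y` on the plane, with their dual basis. -/
structure ObliqueFrame where
  X : Plane →L[ℝ] ℝ
  Y : Plane →L[ℝ] ℝ
  eX : Plane
  eY : Plane
  X_eX : X eX = 1
  Y_eX : Y eX = 0
  X_eY : X eY = 0
  Y_eY : Y eY = 1
  repr : ∀ z, z = X z • eX + Y z • eY
  norm_eX : ‖eX‖ ≤ 2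
  norm_eY : ‖eY‖ ≤ 1

lemma exists_mem_segment_level (f g : Plane →L[ℝ] ℝ) {u v : Plane} {a : ℝ} (hu : f u ≤ a)
    (hv : a ≤ f v) :
    ∃ q ∈ segment ℝ u v, f q = a ∧ min (g u) (g v) ≤ g q ∧ g q ≤ max (g u) (g v) := by
  have h1 : a ∈ segment ℝ (f u) (f v) := by
    rw [segment_eq_Icc (hu.trans hv)]
    exact ⟨hu, hv⟩
  obtain ⟨s, t, hs, ht, hst, rfl⟩ := h1
  refine ⟨s • u + t • v, ⟨s, t, hs, ht, hst, rfl⟩, by simp, ?_, ?_⟩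
  · simp only [map_add, map_smul, smul_eq_mul]
    have h2 := mul_le_mul_of_nonneg_left (min_le_left (g u) (g v)) hs
    have h3 := mul_le_mul_of_nonneg_left (min_le_right (g u) (g v)) ht
    have h4 : s * min (g u) (g v) + t * min (g u) (g v) = min (g u) (g v) := by
      rw [← add_mul, hst, one_mul]
    linarith
  · simp only [map_add, map_smul, smul_eq_mul]
    have h2 := mul_le_mul_of_nonneg_left (le_max_left (g u) (g v)) hs
    have h3 := mul_le_mul_of_nonneg_left (le_max_right (g u) (g v)) ht
    have h4 : s * max (g u) (g v) + t * max (g u) (g v) = max (g u) (g v) := by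
      rw [← add_mul, hst, one_mul]
    linarith

lemma exists_add_smul_mem {K : Set Plane} {z : Plane} (hz : z ∈ interior K) (e : Plane) :
    ∃ δ : ℝ, 0 < δ ∧ z + δ • e ∈ K := by
  have hcont : Filter.Tendsto (fun t : ℝ => z + t • e) (nhdsWithin 0 (Set.Ioi 0)) (nhds z) := by
    have : Continuous (fun t : ℝ => z + t • e) := by fun_prop
    have h0 := this.tendsto 0
    simp only [zero_smul, add_zero] at h0
    exact h0.mono_left nhdsWithin_le_nhds
  have hev := hcont.eventually (mem_interior_iff_mem_nhds.1 hz)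
  obtain ⟨t, ht, ht0⟩ := (hev.and self_mem_nhdsWithin).exists
  exact ⟨t, ht0, ht⟩

namespace ObliqueFrame

variable (B : ObliqueFrame)

/-- The frame with the first coordinate reversed. -/
def flip : ObliqueFrame where
  X := -B.X
  Y := B.Y
  eX := -B.eX
  eY := B.eY
  X_eX := by simp [B.X_eX]
  Y_eX := by simp [B.Y_eX]
  X_eY := by simp [B.X_eY]
  Y_eY := B.Y_eY
  repr z := by simpa using B.repr z
  norm_eX := by simpa using B.norm_eX
  norm_eY := B.norm_eY

@[simp] lemma flip_X (z : Plane) : B.flip.X z = -B.X z := rfl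

@[simp] lemma flip_Y (z : Plane) : B.flip.Y z = B.Y z := rfl

lemma ext_coord {x y : Plane} (hX : B.X x = B.X y) (hY : B.Y x = B.Y y) : x = y := by
  rw [B.repr x, B.repr y, hX, hY]

lemma dist_le (x y : Plane) : dist x y ≤ 2 * |B.X x - B.X y| + |B.Y x - B.Y y| := by
  rw [dist_eq_norm, B.repr (x - y), map_sub, map_sub]
  refine (norm_add_le _ _).trans ?_
  rw [norm_smul, norm_smul, Real.norm_eq_abs, Real.norm_eq_abs]
  nlinarith [mul_le_mul_of_nonneg_left B.norm_eX (abs_nonneg (B.X x - B.X y)),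
    mul_le_mul_of_nonneg_left B.norm_eY (abs_nonneg (B.Y x - B.Y y))]

/-- On the far side of its minimum, a linear functional increases along the lower boundary of a
convex set. -/
lemma sub_le_of_lowest {K : Set Plane} (hK : Convex ℝ K) {p : Plane}
    (hlow : ∀ z ∈ K, B.X z = B.X p → B.Y p ≤ B.Y z) {a : ℝ} {m : Plane} (hm : m ∈ K)
    (hmin : ∀ z ∈ K, B.Y m - a * B.X m ≤ B.Y z - a * B.X z) (hmp : B.X m ≤ B.X p)
    {z : Plane} (hz : z ∈ K) (hpz : B.X p ≤ B.X z) :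
    B.Y p - a * B.X p ≤ B.Y z - a * B.X z := by
  -- The chord from the minimiser `m` to `z` crosses the column of `p` at a point `q` not below `p`,
  -- and the functional at `q` is at most its value at `z`.
  obtain ⟨q, hq, hqX, -, hqf⟩ := exists_mem_segment_level B.X (B.Y - a • B.X) hmp hpz
  have hqK := hK.segment_subset hm hz hq
  have h1 := hlow q hqK hqX
  have h2 := hmin z hz
  simp only [sub_apply, smul_apply, smul_eq_mul,
    max_eq_right h2, hqX] at hqf
  linarith

/-- Sliding up along the lower boundary of a convex body, up to the rightmost point of the part of
the body below the level `H`. -/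
lemma slide {R C V K : Set Plane} (hK : IsWall R C V K) {p m m' : Plane} {H a : ℝ} (ha : 0 < a)
    (hp : p ∈ K) (hlow : ∀ z ∈ K, B.X z = B.X p → B.Y p ≤ B.Y z) (hpH : B.Y p ≤ H)
    (hm : m ∈ K) (hmin : ∀ z ∈ K, B.Y m ≤ B.Y z) (hmp : B.X m ≤ B.X p)
    (hm' : m' ∈ K) (hmin' : ∀ z ∈ K, B.Y m' - a * B.X m' ≤ B.Y z - a * B.X z) :
    ∃ b ∈ K \ interior K, B.Y p ≤ B.Y b ∧ B.Y b ≤ H ∧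
      (B.Y b = H ∨ ∀ z ∈ K, B.X z ≤ B.X b) ∧
      geod R p b ≤ ENNReal.ofReal
        (2 * (B.X m' - B.X m) + (2 / a + 1) * (B.Y b - B.Y p)) := by
  have hasc : ∀ z ∈ K, B.X p ≤ B.X z → B.Y p ≤ B.Y z := fun z hz hpz => by
    have := B.sub_le_of_lowest hK.convex hlow (a := 0) hm (by simpa using hmin) hmp hz hpz
    simpa using this
  have hcomp : IsCompact (K ∩ {z | B.Y z ≤ H}) :=
    hK.compact.inter_right (isClosed_le B.Y.continuous continuous_const)
  obtain ⟨b, ⟨hbK, hbH⟩, hbmax⟩ :=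
    hcomp.exists_isMaxOn ⟨p, hp, hpH⟩ B.X.continuous.continuousOn
  have hbH : B.Y b ≤ H := hbH
  have hbmax : ∀ z ∈ K, B.Y z ≤ H → B.X z ≤ B.X b := fun z hz hzH => hbmax ⟨hz, hzH⟩
  have hpbX : B.X p ≤ B.X b := hbmax p hp hpH
  have hpbY : B.Y p ≤ B.Y b := hasc b hbK hpbX
  -- The corner `c` joins `p` to `b` by a level step and a vertical step. Both avoid the interior of
  -- `K`: an interior point on the first could be lowered below `p`, one on the second moved to the
  -- right of `b`. Projecting to `K` fixes `p` and `b` and lengthens nothing.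
  set c : Plane := p + (B.X b - B.X p) • B.eX with hc
  have hcX : B.X c = B.X b := by simp [hc, B.X_eX]
  have hcY : B.Y c = B.Y p := by simp [hc, B.Y_eX]
  have hpc : ∀ z ∈ segment ℝ p c, z ∉ interior K := by
    rintro _ ⟨s, t, hs, ht, hst, rfl⟩ hz
    obtain ⟨δ, hδ, hzδ⟩ := exists_add_smul_mem hz (-B.eY)
    have h1 := hasc _ hzδ (by
      simp only [map_add, map_smul, map_neg, smul_eq_mul, B.X_eY, hcX]
      obtain rfl : s = 1 - t := by linarith
      nlinarith)
    simp only [map_add, map_smul, map_neg, smul_eq_mul, B.Y_eY, hcY, ← add_mul, hst] at h1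
    linarith
  have hcb : ∀ z ∈ segment ℝ c b, z ∉ interior K := by
    rintro _ ⟨s, t, hs, ht, hst, rfl⟩ hz
    obtain ⟨δ, hδ, hzδ⟩ := exists_add_smul_mem hz B.eX
    have h1 := hbmax _ hzδ (by
      simp only [map_add, map_smul, smul_eq_mul, B.Y_eX, hcY]
      obtain rfl : s = 1 - t := by linarith
      nlinarith)
    simp only [map_add, map_smul, smul_eq_mul, B.X_eX, hcX, ← add_mul, hst] at h1
    linarith
  obtain ⟨π, hπ⟩ := exists_isMetricProj hK.compact.isClosed hK.convex hK.nonempty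
  have g1 := hK.geod_proj_segment_le hπ hpc
  have g2 := hK.geod_proj_segment_le hπ hcb
  have hgeod := geod_trans dist_nonneg dist_nonneg g1 g2
  rw [hπ.eq_self hp, hπ.eq_self hbK] at hgeod
  have d1 := B.dist_le p c
  have d2 := B.dist_le c b
  rw [hcX, hcY, sub_self, abs_zero, abs_sub_comm, abs_of_nonneg (sub_nonneg.2 hpbX)] at d1
  rw [hcX, hcY, sub_self, abs_zero, abs_sub_comm, abs_of_nonneg (sub_nonneg.2 hpbY)] at d2
  -- The flat part lies between `m` and `m'`. To the right of `m'` the lower boundary ascends with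
  -- slope at least `a`, so width is at most rise over `a`.
  have hwidth : B.X b - B.X p ≤ (B.X m' - B.X m) + (B.Y b - B.Y p) / a := by
    rw [← sub_le_iff_le_add', le_div_iff₀ ha]
    have h0 : B.X m ≤ B.X m' := by
      have h1 := hmin' m hm
      have h2 := hmin m' hm'
      by_contra! h3
      nlinarith
    rcases le_total (B.X m') (B.X p) with h | h
    · have h1 := B.sub_le_of_lowest hK.convex hlow hm' hmin' h hbK hpbX
      nlinarith
    · have h1 := hmin' b hbK
      have h2 := hasc m' hm' h
      nlinarith
  refine ⟨b, ⟨hbK, hcb b (right_mem_segment ℝ c b)⟩, hpbY, hbH, ?_,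
    hgeod.trans (ENNReal.ofReal_le_ofReal ?_)⟩
  -- A point of `K` to the right of `b` lies above `H`, and the chord to it from `b` meets level `H`
  -- to the right of `b`.
  · by_contra! hcon
    obtain ⟨hne, z, hz, hbz⟩ := hcon
    have hlt : B.Y b < H := lt_of_le_of_ne hbH hne
    have hzH : H < B.Y z := by
      by_contra! hzH
      exact absurd (hbmax z hz hzH) (not_le.2 hbz)
    obtain ⟨q, hq, hqY, -⟩ := exists_mem_segment_level B.Y B.X hlt.le hzH.le
    have h1 := hbmax q (hK.convex.segment_subset hbK hz hq) hqY.le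
    obtain ⟨s, t, hs, ht, hst, rfl⟩ := hq
    simp only [map_add, map_smul, smul_eq_mul] at h1 hqY
    obtain rfl : s = 1 - t := by linarith
    have ht0 : 0 < t := by
      rcases ht.eq_or_lt with h | h
      · rw [← h] at hqY; linarith
      · exact h
    nlinarith [mul_pos ht0 (sub_pos.2 hbz)]
  · have e : (2 / a + 1) * (B.Y b - B.Y p)
        = 2 * ((B.Y b - B.Y p) / a) + (B.Y b - B.Y p) := by ring
    rw [e]
    linarith

/-- A rising path has passed `K` on the right: the part of `K` above the current point `p` lies to
its left, and `K` has a rightmost point not above `p`. -/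
def PassedRight (K : Set Plane) (p : Plane) : Prop :=
  ∃ b ∈ K, B.Y b ≤ B.Y p ∧ (∀ z ∈ K, B.X z ≤ B.X b) ∧ ∀ z ∈ K, B.Y p ≤ B.Y z → B.X z ≤ B.X p

variable {B}

lemma PassedRight.of_rightmost {K : Set Plane} {b : Plane} (hb : b ∈ K)
    (hmax : ∀ z ∈ K, B.X z ≤ B.X b) : B.PassedRight K b :=
  ⟨b, hb, le_rfl, hmax, fun z hz _ => hmax z hz⟩

lemma PassedRight.vertical {K : Set Plane} {p q : Plane} (hp : B.PassedRight K p)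
    (hX : B.X q = B.X p) (hY : B.Y p ≤ B.Y q) : B.PassedRight K q := by
  obtain ⟨b, hb, hbY, hmax, h⟩ := hp
  exact ⟨b, hb, hbY.trans hY, hmax, fun z hz hz' => hX ▸ h z hz (hY.trans hz')⟩

lemma PassedRight.notMem_interior {K : Set Plane} {p z : Plane} (hp : B.PassedRight K p)
    (hX : B.X z = B.X p) (hY : B.Y p ≤ B.Y z) : z ∉ interior K := by
  intro hz
  obtain ⟨b, hb, hbY, hmax, h⟩ := hp
  obtain ⟨δ, hδ, hzδ⟩ := exists_add_smul_mem hz B.eX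
  have h1 := h _ hzδ (by simpa [B.Y_eX] using hY)
  simp only [map_add, map_smul, smul_eq_mul, B.X_eX] at h1
  linarith

/-- Crossing segments: if some `z` in `K` not below `q` lay to the right of `q`, the chord from `b`
to `z` would cross the levels of `p` and `q` at points `u` and `v`. Here `u` is not to the right of
`p`, while `v` is strictly to the right of `q` because `b` is rightmost. So the segments `p q` and
`u v` share a point, which lies in `K`. -/
lemma PassedRight.of_segment {K : Set Plane} (hK : Convex ℝ K) {p q : Plane}
    (hp : B.PassedRight K p) (hY : B.Y p ≤ B.Y q) (hpq : ∀ z ∈ segment ℝ p q, z ∉ K) :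
    B.PassedRight K q := by
  obtain ⟨b, hb, hbY, hmax, h⟩ := hp
  refine ⟨b, hb, hbY.trans hY, hmax, fun z hz hqz => ?_⟩
  by_contra! hlt
  obtain ⟨u, hu, huY, -⟩ := exists_mem_segment_level B.Y B.X hbY (hY.trans hqz)
  obtain ⟨v, hv, hvY, hvX, -⟩ := exists_mem_segment_level B.Y B.X (hbY.trans hY) hqz
  have huK := hK.segment_subset hb hz hu
  have hvK := hK.segment_subset hb hz hv
  rw [min_eq_right (hmax z hz)] at hvX
  have huX := h u huK huY.ge
  set x := B.X p - B.X u with hx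
  set y := B.X v - B.X q with hy
  have hx0 : 0 ≤ x := sub_nonneg.2 huX
  have hy0 : 0 < y := sub_pos.2 (hlt.trans_le hvX)
  have hxy : 0 < x + y := by linarith
  have hs : 0 ≤ y / (x + y) := by positivity
  have ht : 0 ≤ x / (x + y) := by positivity
  have hst : y / (x + y) + x / (x + y) = 1 := by field_simp; ring
  refine hpq ((y / (x + y)) • p + (x / (x + y)) • q) ⟨_, _, hs, ht, hst, rfl⟩ ?_
  have heq : (y / (x + y)) • p + (x / (x + y)) • q
      = (y / (x + y)) • u + (x / (x + y)) • v := by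
    apply B.ext_coord
    · simp only [map_add, map_smul, smul_eq_mul]
      have e1 : B.X p = B.X u + x := by rw [hx]; ring
      have e2 : B.X v = B.X q + y := by rw [hy]; ring
      rw [e1, e2]
      ring
    · simp only [map_add, map_smul, smul_eq_mul, huY, hvY]
  rw [heq]
  exact hK huK hvK hs ht hst

variable (B)

/-- A rising path has passed `K` on one of its two sides. -/
def Passed (K : Set Plane) (p : Plane) : Prop := B.PassedRight K p ∨ B.flip.PassedRight K p

variable {B}

lemma Passed.vertical {K : Set Plane} {p q : Plane} (hp : B.Passed K p)
    (hX : B.X q = B.X p) (hY : B.Y p ≤ B.Y q) : B.Passed K q :=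
  hp.imp (fun h => h.vertical hX hY) (fun h => h.vertical (by simp [hX]) hY)

lemma Passed.notMem_interior {K : Set Plane} {p z : Plane} (hp : B.Passed K p)
    (hX : B.X z = B.X p) (hY : B.Y p ≤ B.Y z) : z ∉ interior K :=
  hp.elim (fun h => h.notMem_interior hX hY) (fun h => h.notMem_interior (by simp [hX]) hY)

lemma Passed.of_segment {K : Set Plane} (hK : Convex ℝ K) {p q : Plane}
    (hp : B.Passed K p) (hY : B.Y p ≤ B.Y q) (hpq : ∀ z ∈ segment ℝ p q, z ∉ K) :
    B.Passed K q :=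
  hp.imp (fun h => h.of_segment hK hY hpq) (fun h => h.of_segment hK hY hpq)

end ObliqueFrame

/-! ### Fields of convex obstacles -/

/-- Pairwise disjoint convex bodies in the interior of a convex body `C`, such that the points of
`C` that are interior to none of them belong to `R`. -/
structure IsObstacleField {ι : Type*} (R C V : Set Plane) (K : ι → Set Plane) : Prop where
  outer : IsWall R C V C
  wall : ∀ i, IsWall R C V (K i)
  disjoint : ∀ i j, i ≠ j → Disjoint (K i) (K j)
  subset_interior : ∀ i, K i ⊆ interior C
  free_subset : ∀ z ∈ C, (∀ i, z ∉ interior (K i)) → z ∈ R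

/-- The last point of a closed set on a segment. -/
lemma exists_last_mem_segment {C : Set Plane} (hC : IsClosed C) {p z g : Plane}
    (hg : g ∈ segment ℝ p z) (hgC : g ∈ C) (hz : z ∉ interior C) :
    ∃ q ∈ segment ℝ p z, q ∈ C ∧ (∀ w ∈ segment ℝ q z, w ∉ interior C) ∧
      dist p g + dist q z ≤ dist p z := by
  set l : ℝ → Plane := fun t => AffineMap.lineMap p z t with hl
  have hlc : Continuous l := AffineMap.lineMap_continuous
  rw [segment_eq_image_lineMap] at hg ⊢
  obtain ⟨u, hu, rfl⟩ := hg
  have hc : IsCompact (Set.Icc (0 : ℝ) 1 ∩ l ⁻¹' C) :=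
    isCompact_Icc.inter_right (hC.preimage hlc)
  obtain ⟨v, hv⟩ := hc.exists_isGreatest ⟨u, hu, hgC⟩
  refine ⟨l v, ⟨v, hv.1.1, rfl⟩, hv.1.2, fun w hw hwC => ?_, ?_⟩
  · obtain ⟨s, hvs, hs1, rfl⟩ : ∃ s, v ≤ s ∧ s ≤ 1 ∧ l s = w := by
      obtain ⟨a, b, ha, hb, hab, rfl⟩ := hw
      obtain rfl : a = 1 - b := by linarith
      have hv1 := hv.1.1.2
      refine ⟨(1 - b) * v + b, by nlinarith, by nlinarith, ?_⟩
      simp only [hl, AffineMap.lineMap_apply_module]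
      module
    rcases hs1.eq_or_lt with h1 | h1
    · subst h1
      exact hz (by simpa [hl] using hwC)
    · have hnhds : ∀ᶠ t in nhds s, l t ∈ interior C :=
        hlc.continuousAt.eventually_mem (isOpen_interior.mem_nhds hwC)
      obtain ⟨t, ht, hst, ht1⟩ := ((hnhds.filter_mono nhdsWithin_le_nhds).and
        (Ioo_mem_nhdsGT h1)).exists
      have hs0 : 0 ≤ s := hv.1.1.1.trans hvs
      have := hv.2 ⟨⟨hs0.trans hst.le, ht1.le⟩, interior_subset (s := C) ht⟩
      linarith
  · have huv : u ≤ v := hv.2 ⟨hu, hgC⟩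
    have h1 : dist p (AffineMap.lineMap p z u) = u * dist p z := by
      rw [dist_left_lineMap, Real.norm_of_nonneg hu.1]
    have h2 : dist (l v) z = (1 - v) * dist p z := by
      simp only [hl]
      rw [dist_lineMap_right, Real.norm_of_nonneg (sub_nonneg.2 hv.1.1.2)]
    rw [h1, h2]
    nlinarith [dist_nonneg (x := p) (y := z)]

namespace IsObstacleField

variable {ι : Type*} {R C V : Set Plane} {K : ι → Set Plane}

lemma notMem_interior_of_mem (hF : IsObstacleField R C V K) {i : ι} {z : Plane} (hz : z ∈ K i)
    (hz' : z ∉ interior (K i)) (j : ι) : z ∉ interior (K j) := by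
  by_cases hij : j = i
  · rwa [hij]
  · exact fun h => (Set.disjoint_left.1 (hF.disjoint j i hij)) (interior_subset h) hz

lemma geod_le_of_free (hF : IsObstacleField R C V K) {p q : Plane} (hp : p ∈ C) (hq : q ∈ C)
    (hfree : ∀ z ∈ segment ℝ p q, ∀ i, z ∉ interior (K i)) :
    geod R p q ≤ ENNReal.ofReal (dist p q) :=
  geod_le_dist fun z hz =>
    hF.free_subset z (hF.outer.convex.segment_subset hp hq hz) (hfree z hz)

lemma exists_first_hit [Finite ι] (hF : IsObstacleField R C V K) {p z : Plane}
    (hp : ∀ i, p ∉ interior (K i)) (hhit : ∃ i, ∃ w ∈ segment ℝ p z, w ∈ interior (K i)) :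
    ∃ i, (∃ g ∈ segment ℝ p z, g ∈ interior (K i)) ∧ ∃ q ∈ segment ℝ p z, q ∈ K i ∧
      ∀ w ∈ segment ℝ p q, ∀ j, w ∉ interior (K j) := by
  set l : ℝ → Plane := fun t => AffineMap.lineMap p z t with hl
  have hlc : Continuous l := AffineMap.lineMap_continuous
  have hseg : ∀ w, w ∈ segment ℝ p z ↔ ∃ t ∈ Set.Icc (0 : ℝ) 1, l t = w := by
    intro w; rw [segment_eq_image_lineMap]; rfl
  -- Only obstacles whose interior is entered compete for the first hit; those merely touched do not
  -- obstruct. The value `0` for the others is never used.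
  have hleast : ∀ i, ∃ t, (∃ w ∈ segment ℝ p z, w ∈ interior (K i)) →
      IsLeast (Set.Icc (0 : ℝ) 1 ∩ l ⁻¹' K i) t := by
    intro i
    by_cases h : ∃ w ∈ segment ℝ p z, w ∈ interior (K i)
    · have hc : IsCompact (Set.Icc (0 : ℝ) 1 ∩ l ⁻¹' K i) :=
        isCompact_Icc.inter_right ((hF.wall i).compact.isClosed.preimage hlc)
      obtain ⟨w, hw, hwi⟩ := h
      obtain ⟨t, ht, rfl⟩ := (hseg w).1 hw
      obtain ⟨t₀, ht₀⟩ := hc.exists_isLeast ⟨t, ht, interior_subset (s := K i) hwi⟩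
      exact ⟨t₀, fun _ => ht₀⟩
    · exact ⟨0, fun h' => absurd h' h⟩
  choose τ hτ using hleast
  obtain ⟨i, hi, hmin⟩ := Set.exists_min_image {i | ∃ w ∈ segment ℝ p z, w ∈ interior (K i)} τ
    (Set.toFinite _) hhit
  have hτi := hτ i hi
  refine ⟨i, hi, l (τ i), (hseg _).2 ⟨τ i, hτi.1.1, rfl⟩, hτi.1.2, fun w hw j hwj => ?_⟩
  have hpτ : l (τ i) ∈ segment ℝ p z := (hseg _).2 ⟨τ i, hτi.1.1, rfl⟩
  have hwz : w ∈ segment ℝ p z :=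
    (convex_segment p z).segment_subset (left_mem_segment ℝ p z) hpτ hw
  obtain ⟨s, hs, hsτ, rfl⟩ : ∃ s, 0 ≤ s ∧ s ≤ τ i ∧ l s = w := by
    rw [segment_eq_image_lineMap] at hw
    obtain ⟨r, hr, rfl⟩ := hw
    refine ⟨r * τ i, mul_nonneg hr.1 hτi.1.1.1, mul_le_of_le_one_left hτi.1.1.1 hr.2, ?_⟩
    simp only [hl, AffineMap.lineMap_apply, vsub_eq_sub, vadd_eq_add, add_sub_cancel_right,
      smul_smul]
  have hs1 : s ≤ 1 := hsτ.trans hτi.1.1.2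
  have hj : ∃ w ∈ segment ℝ p z, w ∈ interior (K j) := ⟨_, hwz, hwj⟩
  have h1 : τ j ≤ s := (hτ j hj).2 ⟨⟨hs, hs1⟩, interior_subset (s := K j) hwj⟩
  rcases hs.eq_or_lt with h0 | h0
  · subst h0
    exact hp j (by simpa [hl] using hwj)
  · have hnhds : ∀ᶠ t in nhds s, l t ∈ interior (K j) :=
      hlc.continuousAt.eventually_mem (isOpen_interior.mem_nhds hwj)
    obtain ⟨t, ht, ht0, hts⟩ := ((hnhds.filter_mono nhdsWithin_le_nhds).and
      (Ioo_mem_nhdsLT h0)).exists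
    have h2 : τ j ≤ t := (hτ j hj).2 ⟨⟨ht0.le, hts.le.trans hs1⟩, interior_subset (s := K j) ht⟩
    have h3 := hmin j hj
    linarith

/-- A rising path from `p` to the level `H` or to the boundary of `C`. -/
lemma ascend [Finite ι] [DecidableEq ι] (hF : IsObstacleField R C V K) (B : ObliqueFrame)
    {a H : ℝ} (ha : 0 < a) {m mr ml : ι → Plane} (hm : ∀ i, m i ∈ K i) (hmr : ∀ i, mr i ∈ K i)
    (hml : ∀ i, ml i ∈ K i) (hmin : ∀ i, ∀ z ∈ K i, B.Y (m i) ≤ B.Y z)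
    (hminr : ∀ i, ∀ z ∈ K i, B.Y (mr i) - a * B.X (mr i) ≤ B.Y z - a * B.X z)
    (hminl : ∀ i, ∀ z ∈ K i, B.Y (ml i) + a * B.X (ml i) ≤ B.Y z + a * B.X z)
    (S : Finset ι) : ∀ p ∈ C, (∀ i, p ∉ interior (K i)) → B.Y p ≤ H →
      (∀ i, i ∉ S → B.Passed (K i) p) →
      ∃ q ∈ C, (∀ i, q ∉ interior (K i)) ∧ B.Y p ≤ B.Y q ∧ B.Y q ≤ H ∧
        (B.Y q = H ∨ q ∉ interior C) ∧
        geod R p q ≤ ENNReal.ofReal (2 * ∑ i ∈ S, (B.X (mr i) - B.X (ml i)) +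
          (2 / a + 1) * (B.Y q - B.Y p)) := by
  have hwr : ∀ i, B.X (m i) ≤ B.X (mr i) := fun i => by
    have h1 := hminr i _ (hm i)
    have h2 := hmin i _ (hmr i)
    by_contra! h3
    nlinarith
  have hwl : ∀ i, B.X (ml i) ≤ B.X (m i) := fun i => by
    have h1 := hminl i _ (hm i)
    have h2 := hmin i _ (hml i)
    by_contra! h3
    nlinarith
  have hw0 : ∀ i, 0 ≤ B.X (mr i) - B.X (ml i) := fun i => by linarith [hwr i, hwl i]
  have hc : 1 ≤ 2 / a + 1 := by
    have : 0 < 2 / a := by positivity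
    linarith
  -- `S` contains every obstacle not yet passed. Each hit removes one of them, so each flat width is
  -- paid at most once.
  induction S using Finset.strongInduction with
  | H S ih =>
  intro p hpC hpfree hpH hpass
  set z : Plane := p + (H - B.Y p) • B.eY with hz
  have hzX : B.X z = B.X p := by simp [hz, B.X_eY]
  have hzY : B.Y z = H := by simp [hz, B.Y_eY]
  have hsegX : ∀ w ∈ segment ℝ p z, B.X w = B.X p := by
    rintro _ ⟨s, t, hs, ht, hst, rfl⟩
    simp only [map_add, map_smul, smul_eq_mul, hzX, ← add_mul, hst, one_mul]
  have hsegY : ∀ w ∈ segment ℝ p z, B.Y p ≤ B.Y w ∧ B.Y w ≤ H := by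
    rintro _ ⟨s, t, hs, ht, hst, rfl⟩
    simp only [map_add, map_smul, smul_eq_mul, hzY]
    obtain rfl : s = 1 - t := by linarith
    constructor <;> nlinarith
  have hdist : ∀ w ∈ segment ℝ p z, dist p w ≤ B.Y w - B.Y p := by
    intro w hw
    have h1 := B.dist_le p w
    rw [hsegX w hw, sub_self, abs_zero, abs_sub_comm,
      abs_of_nonneg (sub_nonneg.2 (hsegY w hw).1)] at h1
    linarith
  have hsub : ∀ w ∈ segment ℝ p z, segment ℝ p w ⊆ segment ℝ p z := fun w hw =>
    (convex_segment p z).segment_subset (left_mem_segment ℝ p z) hw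
  by_cases hhit : ∃ i, ∃ w ∈ segment ℝ p z, w ∈ interior (K i)
  · obtain ⟨i, ⟨g, hg, hgi⟩, q, hq, hqK, hqfree⟩ := hF.exists_first_hit hpfree hhit
    have hiS : i ∈ S := by
      by_contra hiS
      exact (hpass i hiS).notMem_interior (hsegX g hg) (hsegY g hg).1 hgi
    have hq_int := hqfree q (right_mem_segment ℝ p q)
    have hqC : q ∈ C := interior_subset (hF.subset_interior i hqK)
    have hgeod1 : geod R p q ≤ ENNReal.ofReal (B.Y q - B.Y p) :=
      (hF.geod_le_of_free hpC hqC hqfree).trans (ENNReal.ofReal_le_ofReal (hdist q hq))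
    have hqg : B.Y q < B.Y g := by
      by_contra! hlt
      obtain ⟨u, hu, huY, -⟩ := exists_mem_segment_level B.Y B.X (hsegY g hg).1 hlt
      have : u = g := B.ext_coord ((hsegX u (hsub q hq hu)).trans (hsegX g hg).symm) huY
      exact hqfree u hu i (this ▸ hgi)
    -- The interior point `g` lies above `q` in the same column, so a point of `K i` below `q` would
    -- make `q` interior.
    have hlow : ∀ w ∈ K i, B.X w = B.X q → B.Y q ≤ B.Y w := by
      intro w hw hwX
      by_contra! hlt
      refine hq_int i ((hF.wall i).convex.openSegment_interior_self_subset_interior hgi hw ?_)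
      have hd : 0 < B.Y g - B.Y w := by linarith
      refine ⟨(B.Y q - B.Y w) / (B.Y g - B.Y w), (B.Y g - B.Y q) / (B.Y g - B.Y w),
        div_pos (by linarith) hd, div_pos (by linarith) hd, by field_simp; ring, ?_⟩
      apply B.ext_coord
      · simp only [map_add, map_smul, smul_eq_mul, hwX, hsegX g hg, hsegX q hq]
        field_simp
        ring
      · simp only [map_add, map_smul, smul_eq_mul]
        field_simp
        ring
    obtain ⟨b, hb, hqb, hbH, hbend, hgeod2⟩ : ∃ b ∈ K i \ interior (K i), B.Y q ≤ B.Y b ∧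
        B.Y b ≤ H ∧ (B.Y b = H ∨ B.Passed (K i) b) ∧
        geod R q b ≤ ENNReal.ofReal
          (2 * (B.X (mr i) - B.X (ml i)) + (2 / a + 1) * (B.Y b - B.Y q)) := by
      -- The slide goes away from the lowest point `m i`: to the right, or to the left by
      -- reflection.
      rcases le_total (B.X (m i)) (B.X q) with h | h
      · obtain ⟨b, hb, hqb, hbH, hbend, hgeod⟩ := B.slide (hF.wall i) ha hqK hlow
          (hsegY q hq).2 (hm i) (hmin i) h (hmr i) (hminr i)
        refine ⟨b, hb, hqb, hbH, hbend.imp_right fun h =>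
          Or.inl (ObliqueFrame.PassedRight.of_rightmost hb.1 h),
          hgeod.trans (ENNReal.ofReal_le_ofReal ?_)⟩
        linarith [hwl i]
      · obtain ⟨b, hb, hqb, hbH, hbend, hgeod⟩ := B.flip.slide (hF.wall i) ha hqK
          (fun w hw hwX => hlow w hw (by simpa using hwX))
          (hsegY q hq).2 (hm i) (hmin i) (by simpa using h) (hml i)
          (by simpa using hminl i)
        refine ⟨b, hb, hqb, hbH, hbend.imp_right fun h =>
          Or.inr (ObliqueFrame.PassedRight.of_rightmost hb.1 h),
          hgeod.trans (ENNReal.ofReal_le_ofReal ?_)⟩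
        simp only [ObliqueFrame.flip_X, ObliqueFrame.flip_Y]
        linarith [hwr i]
    have hbC : b ∈ C := interior_subset (hF.subset_interior i hb.1)
    have hbfree := hF.notMem_interior_of_mem hb.1 hb.2
    have hpq := (hsegY q hq).1
    have hgeod := geod_trans (by linarith) (by nlinarith [hw0 i]) hgeod1 hgeod2
    have hsumi : ∑ j ∈ S, (B.X (mr j) - B.X (ml j)) =
        (B.X (mr i) - B.X (ml i)) + ∑ j ∈ S.erase i, (B.X (mr j) - B.X (ml j)) :=
      (Finset.add_sum_erase S _ hiS).symm
    have hrest : 0 ≤ ∑ j ∈ S.erase i, (B.X (mr j) - B.X (ml j)) :=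
      Finset.sum_nonneg fun j _ => hw0 j
    have hmono : B.Y q - B.Y p ≤ (2 / a + 1) * (B.Y q - B.Y p) :=
      le_mul_of_one_le_left (by linarith) hc
    rcases hbend with hbend | hbend
    · refine ⟨b, hbC, hbfree, by linarith, hbH, Or.inl hbend,
        hgeod.trans (ENNReal.ofReal_le_ofReal ?_)⟩
      rw [hsumi]
      nlinarith
    · have hpassb : ∀ j, j ∉ S.erase i → B.Passed (K j) b := by
        intro j hj
        by_cases hji : j = i
        · rwa [hji]
        · have hjS : j ∉ S := fun h => hj (Finset.mem_erase.2 ⟨hji, h⟩)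
          -- The chord `q b` of the convex set `K i` stands in for the boundary walk: it is disjoint
          -- from `K j`, which is all that is needed.
          refine ((hpass j hjS).vertical (hsegX q hq) hpq).of_segment (hF.wall j).convex hqb ?_
          exact fun w hw hwj => Set.disjoint_left.1 (hF.disjoint j i hji) hwj
            ((hF.wall i).convex.segment_subset hqK hb.1 hw)
      obtain ⟨r, hrC, hrfree, hbr, hrH, hrend, hgeod3⟩ :=
        ih _ (Finset.erase_ssubset hiS) b hbC hbfree hbH hpassb
      refine ⟨r, hrC, hrfree, by linarith, hrH, hrend, (geod_trans ?_ ?_ hgeod hgeod3).trans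
        (ENNReal.ofReal_le_ofReal ?_)⟩
      · nlinarith [hw0 i]
      · nlinarith
      · rw [hsumi]
        nlinarith
  · push Not at hhit
    have hsum : 0 ≤ ∑ i ∈ S, (B.X (mr i) - B.X (ml i)) := Finset.sum_nonneg fun i _ => hw0 i
    have hfin : ∀ q ∈ segment ℝ p z, q ∈ C → geod R p q ≤ ENNReal.ofReal
        (2 * ∑ i ∈ S, (B.X (mr i) - B.X (ml i)) + (2 / a + 1) * (B.Y q - B.Y p)) := by
      intro q hq hqC
      refine (hF.geod_le_of_free hpC hqC fun w hw i => hhit i w (hsub q hq hw)).trans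
        (ENNReal.ofReal_le_ofReal ?_)
      have h1 := hdist q hq
      have h2 := (hsegY q hq).1
      nlinarith
    by_cases hzC : z ∈ C
    · exact ⟨z, hzC, fun i => hhit i z (right_mem_segment ℝ p z), by linarith, hzY.le,
        Or.inl hzY, hfin z (right_mem_segment ℝ p z) hzC⟩
    · obtain ⟨q, hq, hqC, hqi, -⟩ := exists_last_mem_segment hF.outer.compact.isClosed
        (left_mem_segment ℝ p z) hpC (fun h => hzC (interior_subset h))
      have hqi := hqi q (left_mem_segment ℝ q z)
      exact ⟨q, hqC, fun i => hhit i q hq, (hsegY q hq).1, (hsegY q hq).2, Or.inr hqi,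
        hfin q hq hqC⟩

/-- Following a segment and walking around the obstacles that it meets. -/
lemma geod_le_of_segment [Finite ι] [DecidableEq ι] (hF : IsObstacleField R C V K) {d : ℝ}
    (hd : 0 < d) (hdiam : ∀ i, ∀ x ∈ K i, ∀ y ∈ K i, dist x y ≤ d) {z : Plane} (hzC : z ∈ C)
    (hz : ∀ i, z ∉ interior (K i)) (S : Finset ι) :
    ∀ p ∈ C, (∀ i, p ∉ interior (K i)) →
      (∀ i, i ∉ S → ∀ w ∈ segment ℝ p z, w ∉ interior (K i)) →
      geod R p z ≤ ENNReal.ofReal (dist p z + 32 * d * S.card) := by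
  induction S using Finset.strongInduction with
  | H S ih =>
  intro p hpC hpfree hS
  by_cases hhit : ∃ i, ∃ w ∈ segment ℝ p z, w ∈ interior (K i)
  · obtain ⟨i, ⟨g, hg, hgi⟩, q, hq, hqK, hqfree⟩ := hF.exists_first_hit hpfree hhit
    have hiS : i ∈ S := by
      by_contra hiS
      exact hS i hiS g hg hgi
    have hqC : q ∈ C := interior_subset (hF.subset_interior i hqK)
    have hgeod1 := hF.geod_le_of_free hpC hqC hqfree
    -- The walk around `K i` leads to the last point `r` of the segment in `K i`, so this obstacle
    -- is not entered again.
    obtain ⟨r, hr, hrK, hrz, hdist⟩ :=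
      exists_last_mem_segment (hF.wall i).compact.isClosed hq hqK (hz i)
    have hrint := hrz r (left_mem_segment ℝ r z)
    have hrC : r ∈ C := interior_subset (hF.subset_interior i hrK)
    have hgeod2 := (hF.wall i).geod_boundary_le ⟨hqK, hqfree q (right_mem_segment ℝ p q) i⟩
      ⟨hrK, hrint⟩ hd (hdiam i)
    have hgeod3 := ih _ (Finset.erase_ssubset hiS) r hrC (hF.notMem_interior_of_mem hrK hrint) (by
      intro j hj w hw
      by_cases hji : j = i
      · exact hji ▸ hrz w hw
      · refine hS j (fun h => hj (Finset.mem_erase.2 ⟨hji, h⟩)) w ?_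
        exact (convex_segment p z).segment_subset hr (right_mem_segment ℝ p z) hw)
    have hcard : (S.card : ℝ) = (S.erase i).card + 1 := by
      rw [← Finset.card_erase_add_one hiS]; push_cast; ring
    refine (geod_trans (by positivity) (by positivity)
      (geod_trans dist_nonneg (by positivity) hgeod1 hgeod2) hgeod3).trans
      (ENNReal.ofReal_le_ofReal ?_)
    rw [hcard]
    linarith
  · push Not at hhit
    refine (hF.geod_le_of_free hpC hzC fun w hw i => hhit i w hw).trans
      (ENNReal.ofReal_le_ofReal ?_)
    have : 0 ≤ 32 * d * S.card := by positivity
    linarith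

end IsObstacleField

/-! ### Averaging over directions and levels -/

/-- The frame with `X = x` and `Y = y + c x`. -/
noncomputable def slopeFrame (c : ℝ) (h0 : 0 ≤ c) (h1 : c ≤ 1) : ObliqueFrame where
  X := EuclideanSpace.proj 0
  Y := EuclideanSpace.proj 1 + c • EuclideanSpace.proj 0
  eX := !₂[1, -c]
  eY := !₂[0, 1]
  X_eX := by simp
  Y_eX := by simp
  X_eY := by simp
  Y_eY := by simp
  repr z := by
    ext i
    fin_cases i
    · simp
    · simp; ring
  norm_eX := by
    rw [EuclideanSpace.norm_eq, Real.sqrt_le_left (by norm_num), Fin.sum_univ_two]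
    simp
    nlinarith
  norm_eY := by
    rw [EuclideanSpace.norm_eq, Real.sqrt_le_left (by norm_num), Fin.sum_univ_two]
    simp

lemma abs_apply_zero_le (z : Plane) : |z 0| ≤ ‖z‖ := by
  simpa using PiLp.norm_apply_le z 0

lemma abs_apply_one_le (z : Plane) : |z 1| ≤ ‖z‖ := by
  simpa using PiLp.norm_apply_le z 1

lemma slopeFrame_abs_X_le {c : ℝ} (h0 : 0 ≤ c) (h1 : c ≤ 1) (z : Plane) :
    |(slopeFrame c h0 h1).X z| ≤ ‖z‖ := abs_apply_zero_le z

lemma slopeFrame_Y {c : ℝ} (h0 : 0 ≤ c) (h1 : c ≤ 1) (z : Plane) :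
    (slopeFrame c h0 h1).Y z = z 1 + c * z 0 := rfl

lemma slopeFrame_abs_Y_le {c : ℝ} (h0 : 0 ≤ c) (h1 : c ≤ 1) (z : Plane) :
    |(slopeFrame c h0 h1).Y z| ≤ 2 * ‖z‖ := by
  rw [slopeFrame_Y]
  refine (abs_add_le _ _).trans ?_
  rw [abs_mul, abs_of_nonneg h0]
  nlinarith [abs_apply_zero_le z, abs_apply_one_le z, abs_nonneg (z 0)]

/-- Some level in an interval of length `r` meets few of the intervals `[y i - e, y i + e]`. -/
lemma exists_level {ι : Type*} [Fintype ι] [Nonempty ι] (y : ι → ℝ) {e r : ℝ} (he : 0 < e)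
    (hr : 0 < r) (u : ℝ) :
    ∃ H ∈ Set.Icc u (u + r), ∃ S : Finset ι, (∀ i, H ∈ Set.Icc (y i - e) (y i + e) → i ∈ S) ∧
      (S.card : ℝ) ≤ 4 * Fintype.card ι * e / r := by
  classical
  -- The number of intervals containing `H` has integral at most `2 e` per interval, so its mean
  -- over the window is at most half the claimed bound. The spare factor `2` makes non-strict
  -- integral inequalities contradictory.
  by_contra! hcon
  set S : ℝ → Finset ι := fun H => Finset.univ.filter fun i => H ∈ Set.Icc (y i - e) (y i + e)
    with hS
  have hlt : ∀ H ∈ Set.Icc u (u + r), 4 * Fintype.card ι * e / r < ((S H).card : ℝ) :=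
    fun H hH => hcon H hH (S H) fun i hi => by simpa [hS] using hi
  have hupper : ∫⁻ H in Set.Icc u (u + r), ((S H).card : ℝ≥0∞)
      ≤ ENNReal.ofReal (2 * Fintype.card ι * e) := by
    calc ∫⁻ H in Set.Icc u (u + r), ((S H).card : ℝ≥0∞)
        ≤ ∫⁻ H, ((S H).card : ℝ≥0∞) := MeasureTheory.setLIntegral_le_lintegral _ _
      _ = ∫⁻ H, ∑ i : ι, (Set.Icc (y i - e) (y i + e)).indicator 1 H := by
          refine MeasureTheory.lintegral_congr fun H => ?_
          simp only [hS, Set.indicator_apply, Pi.one_apply, Finset.sum_boole]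
      _ = ∑ i : ι, ∫⁻ H, (Set.Icc (y i - e) (y i + e)).indicator 1 H :=
          MeasureTheory.lintegral_finsetSum _ fun i _ =>
            measurable_one.indicator measurableSet_Icc
      _ = ∑ _i : ι, ENNReal.ofReal (2 * e) := by
          refine Finset.sum_congr rfl fun i _ => ?_
          rw [MeasureTheory.lintegral_indicator_one measurableSet_Icc, Real.volume_Icc]
          congr 1
          ring
      _ = ENNReal.ofReal (2 * Fintype.card ι * e) := by
          rw [Finset.sum_const, Finset.card_univ, nsmul_eq_mul, ← ENNReal.ofReal_natCast,
            ← ENNReal.ofReal_mul (by positivity)]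
          congr 1
          ring
  have hlower : ENNReal.ofReal (4 * Fintype.card ι * e)
      ≤ ∫⁻ H in Set.Icc u (u + r), ((S H).card : ℝ≥0∞) := by
    calc ENNReal.ofReal (4 * Fintype.card ι * e)
        = ∫⁻ _H in Set.Icc u (u + r), ENNReal.ofReal (4 * Fintype.card ι * e / r) := by
          rw [MeasureTheory.setLIntegral_const, Real.volume_Icc,
            ← ENNReal.ofReal_mul (by positivity)]
          congr 1
          field_simp
          ring
      _ ≤ _ := by
          refine MeasureTheory.setLIntegral_mono' measurableSet_Icc fun H hH => ?_
          rw [← ENNReal.ofReal_natCast]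
          exact ENNReal.ofReal_le_ofReal (hlt H hH).le
  have h1 := hlower.trans hupper
  have hc : (0 : ℝ) < Fintype.card ι := by exact_mod_cast Fintype.card_pos
  rw [ENNReal.ofReal_le_ofReal_iff (by positivity)] at h1
  nlinarith [mul_pos hc he]

namespace IsObstacleField

variable {ι : Type*} [Fintype ι] {R C V : Set Plane} {K : ι → Set Plane}

/-- In one of `N` directions, the obstacles have little boundary almost orthogonal to it, and
rising paths in that direction are short. -/
lemma exists_frame (hF : IsObstacleField R C V K) {d : ℝ}
    (hdiam : ∀ i, ∀ x ∈ K i, ∀ y ∈ K i, dist x y ≤ d) {N : ℕ} (hN : 0 < N) :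
    ∃ B : ObliqueFrame, (∀ z, |B.X z| ≤ ‖z‖) ∧ (∀ z, |B.Y z| ≤ 2 * ‖z‖) ∧
      ∀ p ∈ C, (∀ i, p ∉ interior (K i)) → ∀ H, B.Y p ≤ H →
        ∃ q ∈ C, (∀ i, q ∉ interior (K i)) ∧ B.Y p ≤ B.Y q ∧ B.Y q ≤ H ∧
          (B.Y q = H ∨ q ∉ interior C) ∧
          geod R p q ≤ ENNReal.ofReal (4 * Fintype.card ι * d / N +
            (2 * N + 1) * (B.Y q - B.Y p)) := by
  classical
  have hN' : (0 : ℝ) < N := by exact_mod_cast hN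
  have hex : ∀ (i : ι) (k : ℕ), ∃ m ∈ K i, ∀ z ∈ K i,
      m 1 + (k / N : ℝ) * m 0 ≤ z 1 + (k / N : ℝ) * z 0 := fun i k => by
    obtain ⟨m, hm, hmin⟩ := (hF.wall i).compact.exists_isMinOn (hF.wall i).nonempty
      (f := fun z : Plane => z 1 + (k / N : ℝ) * z 0) (by fun_prop)
    exact ⟨m, hm, fun z hz => hmin hz⟩
  choose m hm hmin using hex
  -- Two-step differences of the minimisers' abscissas telescope to two differences, each at most
  -- `d`.
  have htel : ∀ i, ∑ k ∈ Finset.range N, (m i k 0 - m i (k + 2) 0) ≤ 2 * d := by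
    intro i
    have h1 : ∑ k ∈ Finset.range N, (m i k 0 - m i (k + 2) 0)
        = (m i 0 0 + m i 1 0) - (m i N 0 + m i (N + 1) 0) := by
      rw [← Finset.sum_range_sub' (fun k => m i k 0 + m i (k + 1) 0)]
      exact Finset.sum_congr rfl fun k _ => by ring
    have h2 : ∀ j k, m i j 0 - m i k 0 ≤ d := fun j k => by
      have h3 := hdiam i _ (hm i j) _ (hm i k)
      rw [dist_eq_norm] at h3
      have h4 := (le_abs_self _).trans (abs_apply_zero_le (m i j - m i k))
      rw [PiLp.sub_apply] at h4
      linarith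
    rw [h1]
    linarith [h2 0 N, h2 1 (N + 1)]
  obtain ⟨k, hk, hsum⟩ := Finset.exists_le_of_sum_le (s := Finset.range N)
    (f := fun k => ∑ i, (m i k 0 - m i (k + 2) 0)) (g := fun _ => 2 * Fintype.card ι * d / N)
    (Finset.nonempty_range_iff.2 hN.ne') (by
      rw [Finset.sum_comm, Finset.sum_const, Finset.card_range, nsmul_eq_mul]
      refine (Finset.sum_le_sum fun i _ => htel i).trans (le_of_eq ?_)
      rw [Finset.sum_const, Finset.card_univ, nsmul_eq_mul]
      field_simp)
  have hkN : ((k + 1 : ℕ) : ℝ) ≤ N := by exact_mod_cast Finset.mem_range.1 hk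
  set B := slopeFrame (((k + 1 : ℕ) : ℝ) / N) (by positivity) ((div_le_one hN').2 hkN) with hB
  refine ⟨B, slopeFrame_abs_X_le _ _, slopeFrame_abs_Y_le _ _, fun p hp hpfree H hpH => ?_⟩
  have hX : ∀ z, B.X z = z 0 := fun _ => rfl
  have hYB : ∀ z, B.Y z = z 1 + ((k + 1 : ℕ) : ℝ) / N * z 0 := fun _ => rfl
  -- With `a = 1 / N`, the functionals `Y - a X` and `Y + a X` are the level functions of indices
  -- `k` and `k + 2`, adjacent to the chosen index `k + 1`.
  obtain ⟨q, hq, hqfree, hpq, hqH, hend, hgeod⟩ := hF.ascend B (a := 1 / N) (H := H)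
    (by positivity) (fun i => hm i (k + 1)) (fun i => hm i k) (fun i => hm i (k + 2))
    (fun i z hz => hmin i (k + 1) z hz)
    (fun i z hz => by
      have := hmin i k z hz
      simp only [hYB, hX]
      push_cast
      convert this using 1 <;> ring)
    (fun i z hz => by
      have := hmin i (k + 2) z hz
      simp only [hYB, hX]
      push_cast at this ⊢
      convert this using 1 <;> ring)
    Finset.univ p hp hpfree hpH (fun i hi => absurd (Finset.mem_univ i) hi)
  refine ⟨q, hq, hqfree, hpq, hqH, hend, hgeod.trans (ENNReal.ofReal_le_ofReal ?_)⟩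
  have e1 : 2 / (1 / (N : ℝ)) = 2 * N := by field_simp
  have e2 : 4 * Fintype.card ι * d / N = 2 * (2 * Fintype.card ι * d / N) := by ring
  rw [e1, e2]
  simp only [hX]
  linarith

/-- Escaping to the outer boundary by a rising path. -/
lemma exists_geod_boundary_le (hF : IsObstacleField R C V K) {d D : ℝ}
    (hdiam : ∀ i, ∀ x ∈ K i, ∀ y ∈ K i, dist x y ≤ d) (hD : 0 < D)
    (hdiamC : ∀ x ∈ C, ∀ y ∈ C, dist x y ≤ D) {N : ℕ} (hN : 0 < N) {p : Plane} (hp : p ∈ C)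
    (hpfree : ∀ i, p ∉ interior (K i)) :
    ∃ q ∈ C \ interior C, geod R p q ≤ ENNReal.ofReal
      (4 * Fintype.card ι * d / N + (2 * N + 1) * (2 * D)) := by
  obtain ⟨B, -, hY, h⟩ := hF.exists_frame hdiam hN
  -- Within `C` the level rises by at most `2 D`, so the target `3 D` is unreachable and the path
  -- ends on the outer boundary.
  obtain ⟨q, hq, -, -, -, hend, hgeod⟩ := h p hp hpfree (B.Y p + 3 * D) (by linarith)
  have h1 : B.Y q - B.Y p ≤ 2 * D := by
    have h2 := (le_abs_self _).trans (hY (q - p))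
    rw [map_sub, ← dist_eq_norm] at h2
    linarith [hdiamC q hq p hp]
  refine ⟨q, ⟨hq, hend.resolve_left fun h => by linarith⟩,
    hgeod.trans (ENNReal.ofReal_le_ofReal ?_)⟩
  have := mul_le_mul_of_nonneg_left h1 (by positivity : (0 : ℝ) ≤ 2 * N + 1)
  linarith

/-- Escaping to the outer boundary by a rising path up to a level that meets few obstacles, and
along that level. -/
lemma exists_geod_boundary_le_of_level [Nonempty ι] (hF : IsObstacleField R C V K) {d D r : ℝ}
    (hd : 0 < d) (hdiam : ∀ i, ∀ x ∈ K i, ∀ y ∈ K i, dist x y ≤ d) (hD : 0 < D)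
    (hdiamC : ∀ x ∈ C, ∀ y ∈ C, dist x y ≤ D) (hr : 0 < r) {N : ℕ} (hN : 0 < N) {p : Plane}
    (hp : p ∈ C) (hpfree : ∀ i, p ∉ interior (K i)) :
    ∃ q ∈ C \ interior C, geod R p q ≤ ENNReal.ofReal
      (4 * Fintype.card ι * d / N + (2 * N + 1) * r +
        (D + 32 * d * (8 * Fintype.card ι * d / r))) := by
  classical
  obtain ⟨B, hX, hY, h⟩ := hF.exists_frame hdiam hN
  choose c hc using fun i => (hF.wall i).nonempty
  -- An obstacle of diameter `d` stays within `2 d` of the level of its point `c i`, hence `e = 2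
  -- d`.
  obtain ⟨H, hH, S, hS, hcard⟩ := exists_level (fun i => B.Y (c i)) (e := 2 * d) (by linarith) hr
    (B.Y p)
  obtain ⟨q, hq, hqfree, hpq, hqH, hend, hgeod⟩ := h p hp hpfree H hH.1
  have hgeod1 : geod R p q ≤ ENNReal.ofReal
      (4 * Fintype.card ι * d / N + (2 * N + 1) * r) := by
    refine hgeod.trans (ENNReal.ofReal_le_ofReal ?_)
    have := mul_le_mul_of_nonneg_left (show B.Y q - B.Y p ≤ r by linarith [hH.2])
      (by positivity : (0 : ℝ) ≤ 2 * N + 1)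
    linarith
  by_cases hqi : q ∈ interior C
  · have hqY : B.Y q = H := hend.resolve_right fun h => h hqi
    -- An `X`-step of `D + 1` leaves `C` while staying on the level `H`.
    set f : Plane := q + (D + 1) • B.eX with hf
    have hfC : f ∉ C := by
      intro hfC
      have h1 := (le_abs_self _).trans (hX (f - q))
      rw [← dist_eq_norm, hf, add_sub_cancel_left, map_smul, B.X_eX, smul_eq_mul, mul_one] at h1
      linarith [hdiamC f hfC q hq]
    obtain ⟨z, hz, hzC, hzlast, -⟩ := exists_last_mem_segment hF.outer.compact.isClosed
      (left_mem_segment ℝ q f) hq (fun h => hfC (interior_subset h))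
    have hzint := hzlast z (left_mem_segment ℝ z f)
    have hsegY : ∀ w ∈ segment ℝ q f, B.Y w = H := by
      rintro _ ⟨s, t, hs, ht, hst, rfl⟩
      simp only [hf, map_add, map_smul, smul_eq_mul, B.Y_eX, hqY, mul_zero, add_zero, ← add_mul,
        hst, one_mul]
    have hgeod2 := hF.geod_le_of_segment hd hdiam hzC
      (fun i hi => hzint (hF.subset_interior i (interior_subset hi))) S q hq hqfree (by
        intro i hi w hw hwi
        refine hi (hS i ?_)
        have h1 := hsegY w ((convex_segment q f).segment_subset (left_mem_segment ℝ q f) hz hw)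
        have h2 := hY (w - c i)
        rw [← dist_eq_norm, map_sub, h1] at h2
        have h3 := abs_le.1 (h2.trans (mul_le_mul_of_nonneg_left
          (hdiam i w (interior_subset hwi) _ (hc i)) zero_le_two))
        exact ⟨by linarith [h3.1], by linarith [h3.2]⟩)
    refine ⟨z, ⟨hzC, hzint⟩, (geod_trans (by positivity) (by positivity) hgeod1 hgeod2).trans
      (ENNReal.ofReal_le_ofReal ?_)⟩
    have h1 := hdiamC q hq z hzC
    have h2 : (S.card : ℝ) ≤ 8 * Fintype.card ι * d / r := hcard.trans (le_of_eq (by ring))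
    have h3 := mul_le_mul_of_nonneg_left h2 (by positivity : 0 ≤ 32 * d)
    linarith
  · refine ⟨q, ⟨hq, hqi⟩, hgeod1.trans (ENNReal.ofReal_le_ofReal ?_)⟩
    have : 0 ≤ 32 * d * (8 * Fintype.card ι * d / r) := by positivity
    linarith

end IsObstacleField

/-! ### Polygonal domains with convex holes -/

lemma IsConvexPolygon.isCompact {C : Set Plane} (hC : IsConvexPolygon C) : IsCompact C := by
  obtain ⟨V, hV, -, rfl⟩ := hC
  exact hV.isCompact_convexHull (𝕜 := ℝ)

lemma IsConvexPolygon.convex {C : Set Plane} (hC : IsConvexPolygon C) : Convex ℝ C := by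
  obtain ⟨V, -, -, rfl⟩ := hC
  exact convex_convexHull ℝ V

lemma IsConvexPolygon.nonempty {C : Set Plane} (hC : IsConvexPolygon C) : C.Nonempty := by
  obtain ⟨V, -, hV, rfl⟩ := hC
  exact hV.mono (subset_convexHull ℝ V)

namespace ConvexDomain

variable {h : ℕ} (P : ConvexDomain h)

lemma isWall_outer : IsWall P.region P.outer (⋃ i, P.hole i)ᶜ P.outer where
  convex_ambient := P.outer_polygon.convex
  isOpen := (isClosed_iUnion_of_finite fun i => (P.hole_polygon i).isCompact.isClosed).isOpen_compl
  inter_subset := fun _ hz => ⟨hz.1, hz.2⟩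
  compact := P.outer_polygon.isCompact
  convex := P.outer_polygon.convex
  nonempty_interior := P.outer_interior
  subset := subset_rfl
  boundary_subset := fun z hz hzh => by
    obtain ⟨i, hi⟩ := Set.mem_iUnion.1 hzh
    exact hz.2 (P.hole_subset i hi)

/-- Slightly thickened holes form a field of obstacles that does not contain a given point of the
domain. -/
lemma exists_obstacleField {s : Plane} (hs : s ∈ P.region) {η : ℝ} (hη : 0 < η) :
    ∃ ε, 0 < ε ∧ ε ≤ η ∧
      IsObstacleField P.region P.outer (⋃ i, P.hole i)ᶜ
        (fun i => Metric.cthickening ε (P.hole i)) ∧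
      ∀ i, s ∉ interior (Metric.cthickening ε (P.hole i)) := by
  have hsub : ∀ i, ∀ᶠ ε in nhdsWithin (0 : ℝ) (Set.Ioi 0),
      Metric.cthickening ε (P.hole i) ⊆ interior P.outer ∩ {s}ᶜ := by
    intro i
    obtain ⟨δ, hδ, h⟩ := (P.hole_polygon i).isCompact.exists_cthickening_subset_open
      (isOpen_interior.inter isOpen_compl_singleton) (show P.hole i ⊆ interior P.outer ∩ {s}ᶜ from
        fun z hz => ⟨P.hole_subset i hz, fun hzs => hs.2 (Set.mem_iUnion.2 ⟨i, hzs ▸ hz⟩)⟩)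
    filter_upwards [Ioo_mem_nhdsGT hδ] with ε hε
    exact (Metric.cthickening_mono hε.2.le _).trans h
  have hdisj : ∀ i j, ∀ᶠ ε in nhdsWithin (0 : ℝ) (Set.Ioi 0), i ≠ j →
      Disjoint (Metric.cthickening ε (P.hole i)) (Metric.cthickening ε (P.hole j)) := by
    intro i j
    by_cases hij : i = j
    · exact Filter.Eventually.of_forall fun _ h => absurd hij h
    obtain ⟨δ, hδ, h⟩ := (P.hole_disjoint i j hij).exists_cthickenings
      (P.hole_polygon i).isCompact (P.hole_polygon j).isCompact.isClosed
    filter_upwards [Ioo_mem_nhdsGT hδ] with ε hε _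
    exact h.mono (Metric.cthickening_mono hε.2.le _) (Metric.cthickening_mono hε.2.le _)
  obtain ⟨ε, h1, h2, hε, hεη⟩ := ((Filter.eventually_all.2 hsub).and
    ((Filter.eventually_all.2 fun i => Filter.eventually_all.2 (hdisj i)).and
      (Ioo_mem_nhdsGT hη))).exists
  -- The holes lie in the interiors of their thickenings, so the thickened boundaries avoid all
  -- holes.
  have hin : ∀ i, P.hole i ⊆ interior (Metric.cthickening ε (P.hole i)) := fun i =>
    (Metric.self_subset_thickening hε _).trans
      (interior_maximal (Metric.thickening_subset_cthickening _ _) Metric.isOpen_thickening)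
  have hW := P.isWall_outer
  refine ⟨ε, hε, hεη.le, ⟨hW, fun i => ?_, h2, fun i => (h1 i).trans Set.inter_subset_left, ?_⟩,
    fun i hi => (h1 i (interior_subset hi)).2 rfl⟩
  · refine ⟨hW.convex_ambient, hW.isOpen, hW.inter_subset, (P.hole_polygon i).isCompact.cthickening,
      (P.hole_polygon i).convex.cthickening ε, (P.hole_polygon i).nonempty.mono (hin i),
      fun z hz => interior_subset (h1 i hz).1, fun z hz hzh => ?_⟩
    obtain ⟨j, hj⟩ := Set.mem_iUnion.1 hzh
    by_cases hij : i = j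
    · subst hij
      exact hz.2 (hin i hj)
    · exact Set.disjoint_left.1 (h2 i j hij) hz.1 (interior_subset (hin j hj))
  · refine fun z hz hzf => ⟨hz, fun hzh => ?_⟩
    obtain ⟨j, hj⟩ := Set.mem_iUnion.1 hzh
    exact hzf j (hin j hj)

lemma dist_le_diam {x y : Plane} (hx : x ∈ P.outer) (hy : y ∈ P.outer) :
    dist x y ≤ Metric.diam P.outer :=
  Metric.dist_le_diam_of_mem P.outer_polygon.isCompact.isBounded hx hy

lemma diam_pos : 0 < Metric.diam P.outer := by
  obtain ⟨x, hx⟩ := P.outer_interior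
  obtain ⟨δ, hδ, hxδ⟩ := exists_add_smul_mem hx (EuclideanSpace.single 0 1)
  have h1 := P.dist_le_diam hxδ (interior_subset hx)
  rw [dist_eq_norm, add_sub_cancel_left, norm_smul, Real.norm_of_nonneg hδ.le] at h1
  simp at h1
  linarith

/-- A farthest pair of the outer polygon lies on its boundary, since prolonging the segment at an
interior end would increase the distance. The boundary belongs to the domain. -/
lemma euclideanDiam_region : euclideanDiam P.region = ENNReal.ofReal (Metric.diam P.outer) := by
  apply le_antisymm
  · refine iSup₂_le fun s hs => iSup₂_le fun t ht => ?_
    rw [edist_dist]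
    exact ENNReal.ofReal_le_ofReal (P.dist_le_diam hs.1 ht.1)
  · have hcomp := P.outer_polygon.isCompact
    obtain ⟨⟨x, y⟩, ⟨hx, hy⟩, hmax⟩ := (hcomp.prod hcomp).exists_isMaxOn
      (P.outer_polygon.nonempty.prod P.outer_polygon.nonempty)
      (f := fun z : Plane × Plane => dist z.1 z.2) (by fun_prop)
    have hmax : ∀ u ∈ P.outer, ∀ v ∈ P.outer, dist u v ≤ dist x y :=
      fun u hu v hv => isMaxOn_iff.1 hmax (u, v) ⟨hu, hv⟩
    have hpos : 0 < dist x y :=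
      P.diam_pos.trans_le (Metric.diam_le_of_forall_dist_le dist_nonneg hmax)
    have hbd : ∀ u ∈ P.outer, ∀ v ∈ P.outer, dist u v = dist x y → u ∉ interior P.outer := by
      intro u _ v hv huv hint
      obtain ⟨δ, hδ, hmem⟩ := exists_add_smul_mem hint (u - v)
      have h1 := hmax _ hmem v hv
      have e : u + δ • (u - v) - v = (1 + δ) • (u - v) := by module
      rw [dist_eq_norm, e, norm_smul, Real.norm_of_nonneg (by positivity), ← dist_eq_norm,
        huv] at h1
      nlinarith
    have hreg := P.isWall_outer.boundary_subset_region
    refine le_trans ?_ (le_iSup₂_of_le x (hreg ⟨hx, hbd x hx y hy rfl⟩)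
      (le_iSup₂_of_le y (hreg ⟨hy, hbd y hy x hx (dist_comm y x)⟩) le_rfl))
    rw [edist_dist]
    exact ENNReal.ofReal_le_ofReal (Metric.diam_le_of_forall_dist_le dist_nonneg hmax)

lemma dist_cthickening_le {A : Set Plane} (hA : IsCompact A) {d ε : ℝ} (hε : 0 ≤ ε)
    (hd : ∀ x ∈ A, ∀ y ∈ A, dist x y ≤ d) :
    ∀ x ∈ Metric.cthickening ε A, ∀ y ∈ Metric.cthickening ε A, dist x y ≤ d + 2 * ε := by
  intro x hx y hy
  rw [hA.cthickening_eq_biUnion_closedBall hε] at hx hy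
  obtain ⟨a, ha, hxa⟩ := Set.mem_iUnion₂.1 hx
  obtain ⟨b, hb, hyb⟩ := Set.mem_iUnion₂.1 hy
  have h1 := Metric.mem_closedBall.1 hxa
  have h2 := Metric.mem_closedBall'.1 hyb
  have := dist_triangle4 x a b y
  linarith [hd a ha b hb]

lemma exists_geod_boundary_le_sqrt {Δ : ℝ} (hΔ : 0 ≤ Δ)
    (hhole : ∀ i, ∀ x ∈ P.hole i, ∀ y ∈ P.hole i, dist x y ≤ Δ * Metric.diam P.outer)
    {s : Plane} (hs : s ∈ P.region) :
    ∃ q ∈ P.outer \ interior P.outer, geod P.region s q ≤ ENNReal.ofReal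
      (266 * Metric.diam P.outer * (1 + (h : ℝ) ^ (1 / 2 : ℝ) * Δ ^ (1 / 2 : ℝ))) := by
  have hD := P.diam_pos
  set D := Metric.diam P.outer with hDdef
  -- This `η` makes the thickening add at most `D` to `h d`, to be absorbed by the constant term
  -- `1`.
  obtain ⟨ε, hε, hεle, hF, hsK⟩ := P.exists_obstacleField hs
    (η := D / (2 * (h + 1))) (by positivity)
  have hεh : 2 * ε * h ≤ D := by
    rw [le_div_iff₀ (by positivity)] at hεle
    nlinarith
  have hdiam := fun i => dist_cthickening_le (P.hole_polygon i).isCompact hε.le (hhole i)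
  set d := Δ * D + 2 * ε with hd
  have hd0 : 0 < d := by positivity
  set x := Real.sqrt (h * d / D) with hx
  have hx0 : 0 ≤ x := Real.sqrt_nonneg _
  have hx2 : x * x * D = h * d := by
    rw [hx, Real.mul_self_sqrt (by positivity)]
    field_simp
  -- The choice of about `x` directions balances `h d / N` against `N D`; the `+ 1` keeps `N`
  -- positive when `x = 0`.
  have hxN : x ≤ ((⌈x⌉₊ + 1 : ℕ) : ℝ) := by push_cast; linarith [Nat.le_ceil x]
  have hNx : ((⌈x⌉₊ + 1 : ℕ) : ℝ) ≤ x + 2 := by push_cast; linarith [Nat.ceil_lt_add_one hx0]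
  have hN : 0 < ⌈x⌉₊ + 1 := Nat.succ_pos _
  obtain ⟨q, hq, hgeod⟩ := hF.exists_geod_boundary_le hdiam hD
    (fun u hu v hv => P.dist_le_diam hu hv) hN hs.1 hsK
  refine ⟨q, hq, hgeod.trans (ENNReal.ofReal_le_ofReal ?_)⟩
  generalize ⌈x⌉₊ + 1 = N at *
  have hN' : (0 : ℝ) < N := by exact_mod_cast hN
  have h1 : 4 * (Fintype.card (Fin h) : ℝ) * d / N ≤ 4 * (x * D) := by
    rw [Fintype.card_fin, div_le_iff₀ hN', mul_assoc, ← hx2]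
    nlinarith [mul_le_mul_of_nonneg_left hxN (mul_nonneg hx0 hD.le)]
  have h2 : x ≤ (h : ℝ) ^ (1 / 2 : ℝ) * Δ ^ (1 / 2 : ℝ) + 1 := by
    rw [← Real.sqrt_eq_rpow, ← Real.sqrt_eq_rpow, ← Real.sqrt_mul (Nat.cast_nonneg h), hx]
    refine (Real.sqrt_le_sqrt (y := h * Δ + 1) ?_).trans ?_
    · rw [div_le_iff₀ hD, hd]
      nlinarith
    · rw [Real.sqrt_le_left (by positivity)]
      nlinarith [Real.sq_sqrt (by positivity : 0 ≤ h * Δ), Real.sqrt_nonneg (h * Δ)]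
  have h3 := mul_le_mul_of_nonneg_right hNx hD.le
  have h4 := mul_le_mul_of_nonneg_right h2 hD.le
  have h5 : 0 ≤ (h : ℝ) ^ (1 / 2 : ℝ) * Δ ^ (1 / 2 : ℝ) * D := by positivity
  linarith

/-- With `g = h^(1/4)`, `N = ⌈g⌉` and `r = g² d`, the flat parts and the climb each cost `O(g³ d)`,
the detours along the level only `O(g² d)`. -/
lemma exists_geod_boundary_le_linear (hh : 1 ≤ h) {Δ : ℝ} (hΔ : 0 ≤ Δ)
    (hhole : ∀ i, ∀ x ∈ P.hole i, ∀ y ∈ P.hole i, dist x y ≤ Δ * Metric.diam P.outer)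
    {s : Plane} (hs : s ∈ P.region) :
    ∃ q ∈ P.outer \ interior P.outer, geod P.region s q ≤ ENNReal.ofReal
      (266 * Metric.diam P.outer * (1 + (h : ℝ) ^ (3 / 4 : ℝ) * Δ)) := by
  have hD := P.diam_pos
  set D := Metric.diam P.outer with hDdef
  obtain ⟨ε, hε, hεle, hF, hsK⟩ := P.exists_obstacleField hs
    (η := D / (2 * (h + 1))) (by positivity)
  have hεh : 2 * ε * h ≤ D := by
    rw [le_div_iff₀ (by positivity)] at hεle
    nlinarith
  have hdiam := fun i => dist_cthickening_le (P.hole_polygon i).isCompact hε.le (hhole i)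
  set d := Δ * D + 2 * ε with hd
  have hd0 : 0 < d := by positivity
  have hh1 : (1 : ℝ) ≤ h := by exact_mod_cast hh
  have hh0 : (0 : ℝ) ≤ h := by linarith
  have : Nonempty (Fin h) := ⟨⟨0, hh⟩⟩
  set g := (h : ℝ) ^ (1 / 4 : ℝ) with hg
  have hg1 : 1 ≤ g := Real.one_le_rpow hh1 (by norm_num)
  have hg3 : (h : ℝ) ^ (3 / 4 : ℝ) = g ^ 3 := by
    rw [hg, ← Real.rpow_natCast, ← Real.rpow_mul hh0]; norm_num
  have hg4 : (h : ℝ) = g ^ 4 := by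
    rw [hg, ← Real.rpow_natCast, ← Real.rpow_mul hh0]; norm_num
  have hN : 0 < ⌈g⌉₊ := Nat.ceil_pos.2 (by linarith)
  have hgN : g ≤ (⌈g⌉₊ : ℝ) := Nat.le_ceil g
  have hNg : (⌈g⌉₊ : ℝ) ≤ 2 * g := by linarith [Nat.ceil_lt_add_one (by linarith : 0 ≤ g)]
  obtain ⟨q, hq, hgeod⟩ := hF.exists_geod_boundary_le_of_level hd0 hdiam hD
    (fun u hu v hv => P.dist_le_diam hu hv) (r := g ^ 2 * d) (by positivity) hN hs.1 hsK
  refine ⟨q, hq, hgeod.trans (ENNReal.ofReal_le_ofReal ?_)⟩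
  generalize ⌈g⌉₊ = N at *
  have hN' : (0 : ℝ) < N := by exact_mod_cast hN
  rw [Fintype.card_fin, hg3]
  have hg3d : 0 ≤ g ^ 3 * d := by positivity
  have h1 : 4 * (h : ℝ) * d / N ≤ 4 * (g ^ 3 * d) := by
    rw [div_le_iff₀ hN', hg4]
    nlinarith [mul_le_mul_of_nonneg_left hgN hg3d]
  have h2 : (2 * (N : ℝ) + 1) * (g ^ 2 * d) ≤ 5 * (g ^ 3 * d) := by
    have : 2 * (N : ℝ) + 1 ≤ 5 * g := by linarith
    have := mul_le_mul_of_nonneg_right this (by positivity : 0 ≤ g ^ 2 * d)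
    nlinarith
  have h3 : 32 * d * (8 * h * d / (g ^ 2 * d)) ≤ 256 * (g ^ 3 * d) := by
    have e : 32 * d * (8 * h * d / (g ^ 2 * d)) = 256 * (g ^ 2 * d) := by
      rw [hg4]
      field_simp
      ring
    rw [e]
    nlinarith [mul_le_mul_of_nonneg_right hg1 (by positivity : 0 ≤ g ^ 2 * d)]
  have h4 : g ^ 3 * d ≤ g ^ 3 * Δ * D + D := by
    have : g ^ 3 ≤ h := by
      rw [hg4]
      exact pow_le_pow_right₀ hg1 (by norm_num)
    have := mul_le_mul_of_nonneg_right this (by positivity : 0 ≤ 2 * ε)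
    rw [hd]
    nlinarith
  have h5 : 0 ≤ g ^ 3 * Δ * D := by positivity
  nlinarith

/-- Two escapes and a walk along the outer boundary: `564 = 2 · 266 + 32`. -/
lemma distortion_le {Δ : ℝ} (hΔ : 0 ≤ Δ)
    (hhole : ∀ i, euclideanDiam (P.hole i) ≤ ENNReal.ofReal Δ * euclideanDiam P.region) :
    distortion P ≤ ENNReal.ofReal (564 * (1 + min ((h : ℝ) ^ (3 / 4 : ℝ) * Δ)
      ((h : ℝ) ^ (1 / 2 : ℝ) * Δ ^ (1 / 2 : ℝ)))) := by
  have hD := P.diam_pos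
  have hdist : ∀ i, ∀ x ∈ P.hole i, ∀ y ∈ P.hole i, dist x y ≤ Δ * Metric.diam P.outer := by
    intro i x hx y hy
    have h1 : edist x y ≤ euclideanDiam (P.hole i) :=
      le_iSup₂_of_le x hx (le_iSup₂_of_le y hy le_rfl)
    have h2 := h1.trans (hhole i)
    rw [euclideanDiam_region, ← ENNReal.ofReal_mul hΔ, edist_dist,
      ENNReal.ofReal_le_ofReal_iff (by positivity)] at h2
    exact h2
  set μ := min ((h : ℝ) ^ (3 / 4 : ℝ) * Δ) ((h : ℝ) ^ (1 / 2 : ℝ) * Δ ^ (1 / 2 : ℝ)) with hμ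
  have hμ0 : 0 ≤ μ := le_min (by positivity) (by positivity)
  have hesc : ∀ s ∈ P.region, ∃ q ∈ P.outer \ interior P.outer,
      geod P.region s q ≤ ENNReal.ofReal (266 * Metric.diam P.outer * (1 + μ)) := by
    intro s hs
    rcases min_choice ((h : ℝ) ^ (3 / 4 : ℝ) * Δ) ((h : ℝ) ^ (1 / 2 : ℝ) * Δ ^ (1 / 2 : ℝ))
      with he | he
    -- Without holes there is nothing to average over for the level argument, but both terms of the
    -- minimum vanish.
    · rcases Nat.eq_zero_or_pos h with h0 | h0
      · rw [hμ, he]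
        obtain ⟨q, hq, hg⟩ := P.exists_geod_boundary_le_sqrt hΔ hdist hs
        refine ⟨q, hq, hg.trans (le_of_eq ?_)⟩
        have e1 : ((h : ℝ)) ^ (1 / 2 : ℝ) = 0 := by
          rw [h0, Nat.cast_zero, Real.zero_rpow (by norm_num)]
        have e2 : ((h : ℝ)) ^ (3 / 4 : ℝ) = 0 := by
          rw [h0, Nat.cast_zero, Real.zero_rpow (by norm_num)]
        rw [e1, e2, zero_mul, zero_mul]
      · rw [hμ, he]
        exact P.exists_geod_boundary_le_linear h0 hΔ hdist hs
    · rw [hμ, he]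
      exact P.exists_geod_boundary_le_sqrt hΔ hdist hs
  unfold distortion
  refine ENNReal.div_le_of_le_mul ?_
  rw [euclideanDiam_region, ← ENNReal.ofReal_mul (by positivity)]
  refine iSup₂_le fun s hs => iSup₂_le fun t ht => ?_
  obtain ⟨p, hp, hsp⟩ := hesc s hs
  obtain ⟨q, hq, htq⟩ := hesc t ht
  have hpq := P.isWall_outer.geod_boundary_le hp hq hD fun x hx y hy => P.dist_le_diam hx hy
  rw [geod_comm] at htq
  refine (geod_trans (by positivity) (by positivity) hsp
    (geod_trans (by positivity) (by positivity) hpq htq)).trans (ENNReal.ofReal_le_ofReal ?_)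
  nlinarith [mul_nonneg hD.le hμ0]

end ConvexDomain

theorem theorem2 :
    (∃ C : ℝ, 0 < C ∧ ∀ (h : ℕ) (Δ : ℝ), 0 ≤ Δ → ∀ P : ConvexDomain h,
      (∀ i, euclideanDiam (P.hole i) ≤ ENNReal.ofReal Δ * euclideanDiam P.region) →
      distortion P ≤ ENNReal.ofReal
        (C * (1 + min ((h : ℝ) ^ (3 / 4 : ℝ) * Δ) ((h : ℝ) ^ (1 / 2 : ℝ) * Δ ^ (1 / 2 : ℝ))))) ∧
    (∀ c : ℝ, 0 < c → ∃ C : ℝ, 0 < C ∧ ∀ (h : ℕ) (Δ : ℝ), 1 ≤ h → 0 ≤ Δ →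
      Δ ≤ c * (h : ℝ) ^ (-(1 / 3) : ℝ) → ∀ P : ConvexDomain h,
      (∀ i, euclideanDiam (P.hole i) ≤ ENNReal.ofReal Δ * euclideanDiam P.region) →
      distortion P ≤ ENNReal.ofReal (C * (h : ℝ) ^ (1 / 3 : ℝ))) := by
  refine ⟨⟨564, by norm_num, fun h Δ hΔ P hP => P.distortion_le hΔ hP⟩, fun c hc =>
    ⟨564 * (1 + c ^ (1 / 2 : ℝ)), by positivity, fun h Δ hh hΔ hΔc P hP =>
      (P.distortion_le hΔ hP).trans (ENNReal.ofReal_le_ofReal ?_)⟩⟩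
  have hh1 : (1 : ℝ) ≤ h := by exact_mod_cast hh
  have hh0 : (0 : ℝ) < h := by linarith
  have h1 : 1 ≤ (h : ℝ) ^ (1 / 3 : ℝ) := Real.one_le_rpow hh1 (by norm_num)
  -- The second term of the minimum suffices: `1/2 - 1/6 = 1/3`.
  have h2 : (h : ℝ) ^ (1 / 2 : ℝ) * Δ ^ (1 / 2 : ℝ) ≤ c ^ (1 / 2 : ℝ) * (h : ℝ) ^ (1 / 3 : ℝ) := by
    calc (h : ℝ) ^ (1 / 2 : ℝ) * Δ ^ (1 / 2 : ℝ)
        ≤ (h : ℝ) ^ (1 / 2 : ℝ) * (c * (h : ℝ) ^ (-(1 / 3) : ℝ)) ^ (1 / 2 : ℝ) := by gcongr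
      _ = c ^ (1 / 2 : ℝ) * (h : ℝ) ^ (1 / 3 : ℝ) := by
          rw [Real.mul_rpow hc.le (by positivity), ← Real.rpow_mul hh0.le, mul_left_comm,
            ← Real.rpow_add hh0]
          norm_num
  have h3 := (min_le_right ((h : ℝ) ^ (3 / 4 : ℝ) * Δ) _).trans h2
  nlinarith
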